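/- Let $n\ge 1$. Let $W(\tilde A_{2n-1})$ be the Coxeter group of type $\tilde A_{2n-1}$, seen as the group of all permutations $w$ of $\mathbb Z$ such that $w(i+2n)=w(i)+2n$ for all $i$ and $\sum_{x=1}^{2n}(w(x)-x)=0$; its simple reflections are the elements $s_i$ ($i$ taken modulo $2n$) which exchange $i+2nk$ and $i+1+2nk$ for every $k\in\mathbb Z$ and fix all other integers. Let $\sigma$ be the involution of $W(\tilde A_{2n-1})$ given by conjugation by $i\mapsto 1-i$, so that $\sigma(s_i)=s_{2n-i}$, and let $W(\tilde C_n)$ be the Coxeter group of type $\tilde C_n$, seen as the subgroup of $\sigma$-fixed elements of $W(\tilde A_{2n-1})$, with simple reflections $\sigma_0=s_{2n}$, $\sigma_i=s_is_{2n-i}$ for $1\le i\le n-1$, and $\sigma_n=s_n$. In each of these two groups $W$ a reflection is a conjugate, under $W$, of a simple reflection of $W$; the reflection length $l_W(g)$ is the smallest number of reflections of $W$ whose product is $g$; and for $a,b\in W$ one writes $a\preccurlyeq_W b$ if $l_W(a)+l_W(a^{-1}b)=l_W(b)$. Put $c=s_2s_4\cdots s_{2n}\,s_1s_3\cdots s_{2n-1}$,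 which lies in $W(\tilde C_n)$. Then for all $w,w'\in W(\tilde C_n)$, $$w\preccurlyeq_{W(\tilde C_n)}w'\preccurlyeq_{W(\tilde C_n)}c\quad\text{if and only if}\quad w\preccurlyeq_{W(\tilde A_{2n-1})}w'\preccurlyeq_{W(\tilde A_{2n-1})}c .$$ -/

import Mathlib

namespace DualCTilde

section GeneratedGroup

variable {G : Type*} [Group G]

/-- Length of `g` with respect to a set `S` generating the group as a monoid: the length of a
shortest expression of `g` as a product of elements of `S`. -/
noncomputable def genLength (S : Set G) (g : G) : ℕ :=
  sInf {k | ∃ L : List G, L.length = k ∧ (∀ x ∈ L, x ∈ S) ∧ L.prod = g}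

/-- `a` left divides `b` with respect to the length function of `S`. -/
def Divides (S : Set G) (a b : G) : Prop :=
  genLength S a + genLength S (a⁻¹ * b) = genLength S b

end GeneratedGroup

section Periodic

/-- A permutation `w` of `ℤ` is `N`-periodic if `w (i + N) = w i + N` for all `i`. -/
def IsPeriodic (N : ℕ) (w : Equiv.Perm ℤ) : Prop := ∀ i : ℤ, w (i + N) = w i + N

/-- `N` times the total shift of `w`. -/
noncomputable def shiftSum (N : ℕ) (w : Equiv.Perm ℤ) : ℤ := ∑ x ∈ Finset.Icc (1 : ℤ) N, (w x - x)

theorem IsPeriodic.add_mul {N : ℕ} {w : Equiv.Perm ℤ} (hw : IsPeriodic N w) (i k : ℤ) :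
    w (i + k * N) = w i + k * N := by
  induction k using Int.induction_on with
  | zero => simp
  | succ k ih =>
    have h := hw (i + k * N)
    rw [ih] at h
    rw [show i + ((k : ℤ) + 1) * N = i + k * N + N by ring, h]
    ring
  | pred k ih =>
    have h := hw (i + (-(k : ℤ) - 1) * N)
    rw [show i + (-(k : ℤ) - 1) * N + N = i + -(k : ℤ) * N by ring, ih] at h
    linarith

theorem IsPeriodic.mul {N : ℕ} {v w : Equiv.Perm ℤ} (hv : IsPeriodic N v)
    (hw : IsPeriodic N w) : IsPeriodic N (v * w) := by
  intro i
  simp only [Equiv.Perm.mul_apply, hw i, hv (w i)]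

theorem IsPeriodic.inv {N : ℕ} {w : Equiv.Perm ℤ} (hw : IsPeriodic N w) :
    IsPeriodic N w⁻¹ := by
  intro i
  rw [Equiv.Perm.inv_eq_iff_eq, hw]
  simp

theorem shiftSum_mul {N : ℕ} {v w : Equiv.Perm ℤ} (hv : IsPeriodic N v)
    (hw : IsPeriodic N w) : shiftSum N (v * w) = shiftSum N v + shiftSum N w := by
  rcases Nat.eq_zero_or_pos N with rfl | hN
  · simp [shiftSum]
  have hN' : (0 : ℤ) < N := by exact_mod_cast hN
  have key : ∑ x ∈ Finset.Icc (1 : ℤ) N, (v (w x) - w x) = shiftSum N v := by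
    have hr : ∀ y : ℤ, y = ((y - 1) % N + 1) + ((y - 1) / N) * N := by
      intro y
      have := Int.emod_add_mul_ediv (y - 1) N
      linarith
    have hmaps : ∀ x ∈ Finset.Icc (1 : ℤ) N,
        (w x - 1) % N + 1 ∈ Finset.Icc (1 : ℤ) N := by
      intro x _
      have h1 := Int.emod_nonneg (w x - 1) hN'.ne'
      have h2 := Int.emod_lt_of_pos (w x - 1) hN'
      rw [Finset.mem_Icc]
      constructor <;> linarith
    have hinj : ∀ x ∈ Finset.Icc (1 : ℤ) N, ∀ y ∈ Finset.Icc (1 : ℤ) N,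
        (w x - 1) % N + 1 = (w y - 1) % N + 1 → x = y := by
      intro x hx y hy hxy
      rw [Finset.mem_Icc] at hx hy
      have h1 := hr (w x)
      have h2 := hr (w y)
      have h3 : w x = w (y + ((w x - 1) / N - (w y - 1) / N) * N) := by
        rw [hw.add_mul, sub_mul]
        linarith
      have h4 := w.injective h3
      set q := (w x - 1) / N - (w y - 1) / N
      have h5 : q < 1 := by
        by_contra hq
        have : (N : ℤ) ≤ q * N := by nlinarith
        linarith
      have h6 : -1 < q := by
        by_contra hq
        have : q * N ≤ -(N : ℤ) := by nlinarith
        linarith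
      have h7 : q = 0 := by omega
      rw [h7] at h4
      linarith
    refine Finset.sum_bij (fun x _ => (w x - 1) % N + 1) hmaps
      (fun x hx y hy h => hinj x hx y hy h) ?_ ?_
    · have hsurj := Finset.surj_on_of_inj_on_of_card_le
        (s := Finset.Icc (1 : ℤ) N) (t := Finset.Icc (1 : ℤ) N)
        (fun x _ => (w x - 1) % N + 1) hmaps
        (fun x y hx hy h => hinj x hx y hy h) le_rfl
      intro b hb
      obtain ⟨a, ha, hab⟩ := hsurj b hb
      exact ⟨a, ha, hab.symm⟩
    · intro x _
      have h1 := hr (w x)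
      have h2 := hv.add_mul ((w x - 1) % N + 1) ((w x - 1) / N)
      rw [← h1] at h2
      rw [h2]
      linarith
  have : shiftSum N (v * w)
      = ∑ x ∈ Finset.Icc (1 : ℤ) N, ((v (w x) - w x) + (w x - x)) := by
    refine Finset.sum_congr rfl fun x _ => ?_
    rw [Equiv.Perm.mul_apply]
    ring
  rw [this, Finset.sum_add_distrib, key]
  rfl

/-- The Coxeter group of type `Ã_{N-1}`: the `N`-periodic permutations of `ℤ` with total
shift `0`. -/
def affineA (N : ℕ) : Subgroup (Equiv.Perm ℤ) where
  carrier := {w | IsPeriodic N w ∧ shiftSum N w = 0}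
  mul_mem' := by
    rintro v w ⟨hv, hv0⟩ ⟨hw, hw0⟩
    exact ⟨hv.mul hw, by rw [shiftSum_mul hv hw, hv0, hw0, add_zero]⟩
  one_mem' := ⟨fun i => rfl, by simp [shiftSum]⟩
  inv_mem' := by
    rintro w ⟨hw, hw0⟩
    refine ⟨hw.inv, ?_⟩
    have h := shiftSum_mul hw.inv hw
    rw [inv_mul_cancel, hw0, add_zero] at h
    rw [← h]
    simp [shiftSum]

end Periodic

section Simple

/-- The map underlying the periodic transposition `(i, i + 1)`. -/
def swapFun (N : ℕ) (i j : ℤ) : ℤ :=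
  if (N : ℤ) ∣ j - i then j + 1 else if (N : ℤ) ∣ j - (i + 1) then j - 1 else j

theorem two_mul_not_dvd_one (n : ℕ) : ¬ ((2 * n : ℕ) : ℤ) ∣ 1 := by
  rintro ⟨k, hk⟩
  push_cast at hk
  have : (1 : ℤ) = 2 * (n * k) := by rw [hk]; ring
  omega

theorem swapFun_of_dvd {n : ℕ} {i j : ℤ} (h : ((2 * n : ℕ) : ℤ) ∣ j - i) :
    swapFun (2 * n) i j = j + 1 := if_pos h

theorem swapFun_of_dvd' {n : ℕ} {i j : ℤ} (h : ((2 * n : ℕ) : ℤ) ∣ j - (i + 1)) :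
    swapFun (2 * n) i j = j - 1 := by
  have h' : ¬ ((2 * n : ℕ) : ℤ) ∣ j - i := by
    intro h2
    apply two_mul_not_dvd_one n
    have := dvd_sub h2 h
    rwa [show j - i - (j - (i + 1)) = 1 by ring] at this
  rw [swapFun, if_neg h', if_pos h]

theorem swapFun_involutive (n : ℕ) (i : ℤ) : Function.Involutive (swapFun (2 * n) i) := by
  intro j
  by_cases h1 : ((2 * n : ℕ) : ℤ) ∣ j - i
  · rw [swapFun_of_dvd h1, swapFun_of_dvd' (by rwa [show j + 1 - (i + 1) = j - i by ring])]
    ring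
  · by_cases h2 : ((2 * n : ℕ) : ℤ) ∣ j - (i + 1)
    · rw [swapFun_of_dvd' h2, swapFun_of_dvd (by rwa [show j - 1 - i = j - (i + 1) by ring])]
      ring
    · have : swapFun (2 * n) i j = j := by rw [swapFun, if_neg h1, if_neg h2]
      rw [this, this]

theorem swapFun_add (N : ℕ) (i j : ℤ) : swapFun N i (j + N) = swapFun N i j + N := by
  have e1 : (N : ℤ) ∣ j + N - i ↔ (N : ℤ) ∣ j - i := by
    rw [show j + (N : ℤ) - i = j - i + N by ring]; exact dvd_add_self_right
  have e2 : (N : ℤ) ∣ j + N - (i + 1) ↔ (N : ℤ) ∣ j - (i + 1) := by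
    rw [show j + (N : ℤ) - (i + 1) = j - (i + 1) + N by ring]; exact dvd_add_self_right
  simp only [swapFun, e1, e2]
  split_ifs <;> ring

/-- The `2n`-periodic transposition `(i, i + 1)`, as a permutation of `ℤ`. -/
def simplePerm (n : ℕ) (i : ℤ) : Equiv.Perm ℤ := (swapFun_involutive n i).toPerm

theorem simplePerm_apply (n : ℕ) (i j : ℤ) : simplePerm n i j = swapFun (2 * n) i j := rfl

theorem simplePerm_mem (n : ℕ) (i : ℤ) : simplePerm n i ∈ affineA (2 * n) := by
  have hp : IsPeriodic (2 * n) (simplePerm n i) := fun j => swapFun_add _ i j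
  refine ⟨hp, ?_⟩
  have hsq : simplePerm n i * simplePerm n i = 1 := by
    ext j
    exact swapFun_involutive n i j
  have h := shiftSum_mul hp hp
  rw [hsq] at h
  have h1 : shiftSum (2 * n) 1 = 0 := by simp [shiftSum]
  omega

/-- The simple reflection `s_i` of `W(Ã_{2n-1})`; it depends on `i` modulo `2n` only. -/
def s (n : ℕ) (i : ℤ) : affineA (2 * n) := ⟨simplePerm n i, simplePerm_mem n i⟩

/-- The reflections of `W(Ã_{2n-1})`: all conjugates of simple reflections. -/
def reflectionsA (n : ℕ) : Set (affineA (2 * n)) :=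
  {t | ∃ (g : affineA (2 * n)) (i : ℤ), t = g * s n i * g⁻¹}

end Simple

section Involution

/-- Conjugation by `i ↦ 1 - i` on the permutations of `ℤ`. -/
def sigma : Equiv.Perm ℤ ≃* Equiv.Perm ℤ := MulAut.conj (Equiv.subLeft (1 : ℤ))

theorem sigma_apply (w : Equiv.Perm ℤ) (i : ℤ) : sigma w i = 1 - w (1 - i) := by
  simp only [sigma, MulAut.conj_apply, Equiv.Perm.mul_apply, Equiv.subLeft_apply]
  congr 2
  change -i + 1 = 1 - i
  ring

/-- The involution `sigma` maps `s_i` to `s_{2n-i}`. -/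
theorem sigma_s (n : ℕ) (i : ℤ) :
    sigma (s n i : Equiv.Perm ℤ) = (s n (2 * n - i) : Equiv.Perm ℤ) := by
  ext j
  rw [sigma_apply]
  change 1 - swapFun (2 * n) i (1 - j) = swapFun (2 * n) (2 * n - i) j
  have e1 : ((2 * n : ℕ) : ℤ) ∣ 1 - j - i ↔ ((2 * n : ℕ) : ℤ) ∣ j - (2 * n - i + 1) := by
    rw [← dvd_neg, show j - (2 * (n : ℤ) - i + 1) = -(1 - j - i) + -((2 * n : ℕ) : ℤ) by
      push_cast; ring]
    exact (dvd_add_left (dvd_neg.2 dvd_rfl)).symm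
  have e2 : ((2 * n : ℕ) : ℤ) ∣ 1 - j - (i + 1) ↔ ((2 * n : ℕ) : ℤ) ∣ j - (2 * n - i) := by
    rw [← dvd_neg, show j - (2 * (n : ℤ) - i) = -(1 - j - (i + 1)) + -((2 * n : ℕ) : ℤ) by
      push_cast; ring]
    exact (dvd_add_left (dvd_neg.2 dvd_rfl)).symm
  by_cases h1 : ((2 * n : ℕ) : ℤ) ∣ 1 - j - i
  · rw [swapFun_of_dvd h1, swapFun_of_dvd' (e1.1 h1)]
    ring
  · by_cases h2 : ((2 * n : ℕ) : ℤ) ∣ 1 - j - (i + 1)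
    · rw [swapFun_of_dvd' h2, swapFun_of_dvd (e2.1 h2)]
      ring
    · rw [swapFun, if_neg h1, if_neg h2, swapFun, if_neg (fun h => h2 (e2.2 h)),
        if_neg (fun h => h1 (e1.2 h))]
      ring

/-- The Coxeter group of type `C̃_n`: the fixed points of `sigma` in `W(Ã_{2n-1})`. -/
def affineC (n : ℕ) : Subgroup (affineA (2 * n)) where
  carrier := {w | sigma (w : Equiv.Perm ℤ) = w}
  mul_mem' := by
    intro v w hv hw
    simp only [Set.mem_ofPred_eq, Subgroup.coe_mul, map_mul] at hv hw ⊢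
    rw [hv, hw]
  one_mem' := by simp
  inv_mem' := by
    intro w hw
    simp only [Set.mem_ofPred_eq, Subgroup.coe_inv, map_inv] at hw ⊢
    rw [hw]

/-- The simple reflections of `W(C̃_n)`, for `0 ≤ i ≤ n`: `σ_0 = s_{2n}`, `σ_n = s_n` and
`σ_i = s_i s_{2n-i}` otherwise. -/
def simpleC (n i : ℕ) : affineA (2 * n) :=
  if i = 0 then s n (2 * n) else if i = n then s n n else s n i * s n (2 * n - i)

/-- The reflections of `W(C̃_n)`: all conjugates, under `W(C̃_n)`, of its simple reflections. -/
def reflectionsC (n : ℕ) : Set (affineC n) :=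
  {t | ∃ (g : affineC n) (i : ℕ), i ≤ n ∧
    (t : affineA (2 * n)) = (g : affineA (2 * n)) * simpleC n i * (g : affineA (2 * n))⁻¹}

end Involution

section CoxeterElement

/-- The element `s_2 s_4 ⋯ s_{2n} s_1 s_3 ⋯ s_{2n-1}` of `W(Ã_{2n-1})`. -/
def coxA (n : ℕ) : affineA (2 * n) :=
  ((List.range n).map fun j : ℕ => s n (2 * j + 2)).prod *
    ((List.range n).map fun j : ℕ => s n (2 * j + 1)).prod

theorem not_dvd_of_abs_lt {n : ℕ} {d : ℤ} (h0 : d ≠ 0) (h1 : -(2 * n) < d) (h2 : d < 2 * n) :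
    ¬ ((2 * n : ℕ) : ℤ) ∣ d := by
  intro h
  apply h0
  apply Int.eq_zero_of_abs_lt_dvd h
  rw [abs_lt]
  push_cast
  exact ⟨h1, h2⟩

theorem prod_s_apply (n : ℕ) (b : ℤ) (m : ℕ) (hm : m ≤ n) :
    (∀ (x : ℤ) (q : ℕ), q < n → ((2 * n : ℕ) : ℤ) ∣ x - (2 * q + b) →
      (((List.range m).map fun j : ℕ => s n (2 * j + b)).prod : Equiv.Perm ℤ) x
        = if q < m then x + 1 else x) ∧
    (∀ (x : ℤ) (q : ℕ), q < n → ((2 * n : ℕ) : ℤ) ∣ x - (2 * q + b + 1) →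
      (((List.range m).map fun j : ℕ => s n (2 * j + b)).prod : Equiv.Perm ℤ) x
        = if q < m then x - 1 else x) := by
  induction m with
  | zero => simp
  | succ m ih =>
    obtain ⟨ihA, ihB⟩ := ih (by omega)
    have hs : ∀ x : ℤ,
        (((List.range (m + 1)).map fun j : ℕ => s n (2 * j + b)).prod : Equiv.Perm ℤ) x
        = (((List.range m).map fun j : ℕ => s n (2 * j + b)).prod : Equiv.Perm ℤ)
            (swapFun (2 * n) (2 * m + b) x) := by
      intro x
      rw [List.range_succ, List.map_append, List.prod_append]
      simp only [List.map_cons, List.map_nil, List.prod_cons, List.prod_nil, mul_one,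
        Subgroup.coe_mul, Equiv.Perm.mul_apply]
      rfl
    constructor
    · intro x q hq hx
      rw [hs]
      by_cases hqm : q = m
      · subst hqm
        rw [swapFun_of_dvd hx, ihB (x + 1) q hq
          (by rwa [show x + 1 - (2 * (q : ℤ) + b + 1) = x - (2 * q + b) by ring])]
        simp
      · have n1 : ¬ ((2 * n : ℕ) : ℤ) ∣ x - (2 * m + b) := by
          intro h
          have := dvd_sub h hx
          rw [show x - (2 * (m : ℤ) + b) - (x - (2 * q + b)) = 2 * q - 2 * m by ring] at this
          exact not_dvd_of_abs_lt (by omega) (by omega) (by omega) this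
        have n2 : ¬ ((2 * n : ℕ) : ℤ) ∣ x - (2 * m + b + 1) := by
          intro h
          have := dvd_sub h hx
          rw [show x - (2 * (m : ℤ) + b + 1) - (x - (2 * q + b)) = 2 * q - 2 * m - 1 by
            ring] at this
          exact not_dvd_of_abs_lt (by omega) (by omega) (by omega) this
        rw [swapFun, if_neg n1, if_neg n2, ihA x q hq hx]
        have : q < m ↔ q < m + 1 := by omega
        simp only [this]
    · intro x q hq hx
      rw [hs]
      by_cases hqm : q = m
      · subst hqm
        rw [swapFun_of_dvd' hx, ihA (x - 1) q hq
          (by rwa [show x - 1 - (2 * (q : ℤ) + b) = x - (2 * q + b + 1) by ring])]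
        simp
      · have n1 : ¬ ((2 * n : ℕ) : ℤ) ∣ x - (2 * m + b) := by
          intro h
          have := dvd_sub h hx
          rw [show x - (2 * (m : ℤ) + b) - (x - (2 * q + b + 1)) = 2 * q - 2 * m + 1 by
            ring] at this
          exact not_dvd_of_abs_lt (by omega) (by omega) (by omega) this
        have n2 : ¬ ((2 * n : ℕ) : ℤ) ∣ x - (2 * m + b + 1) := by
          intro h
          have := dvd_sub h hx
          rw [show x - (2 * (m : ℤ) + b + 1) - (x - (2 * q + b + 1)) = 2 * q - 2 * m by
            ring] at this
          exact not_dvd_of_abs_lt (by omega) (by omega) (by omega) this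
        rw [swapFun, if_neg n1, if_neg n2, ihB x q hq hx]
        have : q < m ↔ q < m + 1 := by omega
        simp only [this]

theorem exists_residue {n : ℕ} (hn : 1 ≤ n) {y : ℤ} (hy : y % 2 = 0) :
    ∃ q : ℕ, q < n ∧ ((2 * n : ℕ) : ℤ) ∣ y - 2 * q := by
  have hn' : (0 : ℤ) < n := by exact_mod_cast hn
  have h1 := Int.emod_nonneg (y / 2) hn'.ne'
  have h2 := Int.emod_lt_of_pos (y / 2) hn'
  refine ⟨((y / 2) % n).toNat, by omega, y / 2 / n, ?_⟩
  rw [Int.toNat_of_nonneg h1]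
  have h3 := Int.emod_add_mul_ediv (y / 2) n
  have h4 : y = 2 * (y / 2) := by omega
  push_cast
  linarith

/-- `coxA n` is the permutation `i ↦ i + 2` for odd `i`, `i ↦ i - 2` for even `i`. -/
theorem coxA_apply {n : ℕ} (hn : 1 ≤ n) (x : ℤ) :
    (coxA n : Equiv.Perm ℤ) x = if x % 2 = 1 then x + 2 else x - 2 := by
  have key : ∀ (b y : ℤ),
      (((List.range n).map fun j : ℕ => s n (2 * j + b)).prod : Equiv.Perm ℤ) y
        = if (y - b) % 2 = 0 then y + 1 else y - 1 := by
    intro b y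
    split_ifs with h
    · obtain ⟨q, hq, hd⟩ := exists_residue hn h
      rw [(prod_s_apply n b n le_rfl).1 y q hq
        (by rwa [show y - (2 * (q : ℤ) + b) = y - b - 2 * q by ring]), if_pos hq]
    · obtain ⟨q, hq, hd⟩ := exists_residue hn (y := y - b - 1) (by omega)
      rw [(prod_s_apply n b n le_rfl).2 y q hq
        (by rwa [show y - (2 * (q : ℤ) + b + 1) = y - b - 1 - 2 * q by ring]), if_pos hq]
  rw [coxA, Subgroup.coe_mul, Equiv.Perm.mul_apply, key, key]
  split_ifs <;> omega

theorem coxA_mem (n : ℕ) : coxA n ∈ affineC n := by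
  rcases Nat.eq_zero_or_pos n with rfl | hn
  · exact (affineC 0).one_mem
  · change sigma (coxA n : Equiv.Perm ℤ) = coxA n
    ext x
    rw [sigma_apply, coxA_apply hn, coxA_apply hn]
    split_ifs <;> omega

/-- The Coxeter element `c`, as an element of `W(C̃_n)`. -/
def c (n : ℕ) : affineC n := ⟨coxA n, coxA_mem n⟩

/-- Divisibility in `W(Ã_{2n-1})` for the reflection length. -/
def DividesA (n : ℕ) (a b : affineA (2 * n)) : Prop := Divides (reflectionsA n) a b

/-- Divisibility in `W(C̃_n)` for the reflection length. -/
def DividesC (n : ℕ) (a b : affineC n) : Prop := Divides (reflectionsC n) a b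

end CoxeterElement

end DualCTilde

/-! By subadditivity of reflection length, in either group `w ≼ w' ≼ c` means that the lengths of
the three factors of `c = w · (w⁻¹w') · (w'⁻¹c)` add up to the length of `c`. This length is `2n` in
type `Ã` (`lengthA_c`) and `n + 1` in type `C̃` (`lengthC_c_le`, `le_lengthC_c`). So it suffices to
compare, for factorizations of `c` inside `W(C̃_n)`, the bound `2n` on the sum of the first lengths
with the bound `n + 1` on the sum of the second ones.

From `C̃` to `Ã` (`lengthA_add_le`): a reflection of `W(C̃_n)` is a product of at most two
reflections of `W(Ã_{2n-1})`, and is a single one if it is conjugate to `σ_0` or `σ_n`. Two sign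
characters control the numbers `a` and `b` of factors of these two kinds: for `c`, `a` is odd and `a
+ b` is even, so `a + b ≥ 2`. Hence `n + 1` reflections of `C̃` cost at most `2(n + 1) - 2 = 2n`
reflections of `Ã`.

From `Ã` to `C̃` (`lengthC_add_le`): each factor is written as a product of symmetric reflections
(cost 1) and pairs (cost 2) without waste (`exists_symFactorization`). The tool is the space of
quasi-periodic functions on `ℤ` invariant under `g`. If `g` is elliptic, its length is the
codimension of this space, and the transposition of `i` and `g i`, together with its mirror image if
distinct, splits off. If `g` is not elliptic, the independence of the roots in a shortest
factorization of `c` shows that one reflection makes `g` elliptic; then the residues with infinite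
orbits form exactly two cycles, exchanged by `z ↦ 1 - z`, and a symmetric reflection joining them
makes `g` elliptic as well (`exists_symmetric_mul_elliptic`).

It remains to count. Reflections whose product is `c` have only constant common invariants
(`constant_of_prod_eq_coxA`). Functions invariant under `z ↦ 1 - z` form a space of dimension at
least `n`, on which symmetric reflections impose nothing and each pair imposes one condition; so
there are `b ≥ n - 1` pairs, and `a + 2b ≤ 2n` gives `a + b ≤ n + 1`. -/

namespace DualCTilde

/-! ### Action on residues modulo `2n` -/

section Residues

variable {n : ℕ}

theorem intCast_eq_iff {z w : ℤ} :
    (z : ZMod (2 * n)) = w ↔ ∃ k : ℤ, z = w + k * ((2 * n : ℕ) : ℤ) := by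
  rw [eq_comm, ZMod.intCast_eq_intCast_iff_dvd_sub]
  constructor
  · rintro ⟨k, hk⟩
    exact ⟨k, by linarith⟩
  · rintro ⟨k, hk⟩
    exact ⟨k, by linarith⟩

theorem intCast_eq_iff_dvd {z w : ℤ} :
    (z : ZMod (2 * n)) = w ↔ ((2 * n : ℕ) : ℤ) ∣ z - w := by
  rw [eq_comm, ZMod.intCast_eq_intCast_iff_dvd_sub]

theorem emod_two_eq_of_intCast_eq {z w : ℤ} (h : (z : ZMod (2 * n)) = w) : z % 2 = w % 2 := by
  obtain ⟨k, hk⟩ := intCast_eq_iff.1 h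
  have : z = w + 2 * (k * n) := by rw [hk]; push_cast; ring
  omega

theorem intCast_add_mul (z k : ℤ) :
    ((z + k * ((2 * n : ℕ) : ℤ) : ℤ) : ZMod (2 * n)) = z :=
  intCast_eq_iff.2 ⟨k, rfl⟩

theorem affineA_add_mul (g : affineA (2 * n)) (z k : ℤ) :
    (g : Equiv.Perm ℤ) (z + k * ((2 * n : ℕ) : ℤ))
      = (g : Equiv.Perm ℤ) z + k * ((2 * n : ℕ) : ℤ) :=
  g.2.1.add_mul z k

theorem affineA_intCast_congr (g : affineA (2 * n)) {z w : ℤ} (h : (z : ZMod (2 * n)) = w) :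
    (((g : Equiv.Perm ℤ) z : ℤ) : ZMod (2 * n)) = ((g : Equiv.Perm ℤ) w : ℤ) := by
  obtain ⟨k, rfl⟩ := intCast_eq_iff.1 h
  rw [affineA_add_mul, intCast_add_mul]

theorem affineA_intCast_inj (g : affineA (2 * n)) {z w : ℤ} :
    (((g : Equiv.Perm ℤ) z : ℤ) : ZMod (2 * n)) = ((g : Equiv.Perm ℤ) w : ℤ) ↔
      (z : ZMod (2 * n)) = w := by
  refine ⟨fun h => ?_, affineA_intCast_congr g⟩
  have := affineA_intCast_congr g⁻¹ h
  simpa using this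

theorem affineC_apply_one_sub (g : affineC n) (z : ℤ) :
    ((g : affineA (2 * n)) : Equiv.Perm ℤ) (1 - z)
      = 1 - ((g : affineA (2 * n)) : Equiv.Perm ℤ) z := by
  have h : sigma ((g : affineA (2 * n)) : Equiv.Perm ℤ) = ((g : affineA (2 * n))) := g.2
  have h2 := sigma_apply ((g : affineA (2 * n)) : Equiv.Perm ℤ) z
  rw [h] at h2
  linarith

theorem mem_affineC_of_apply {g : affineA (2 * n)}
    (h : ∀ z : ℤ, (g : Equiv.Perm ℤ) (1 - z) = 1 - (g : Equiv.Perm ℤ) z) : g ∈ affineC n := by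
  change sigma (g : Equiv.Perm ℤ) = g
  ext z
  rw [sigma_apply, h]
  ring

/-- The permutation of `ℤ / 2n` induced by an element of `W(Ã_{2n-1})`. -/
noncomputable def residuePerm (n : ℕ) [NeZero n] :
    affineA (2 * n) →* Equiv.Perm (ZMod (2 * n)) :=
  have key : ∀ (g : affineA (2 * n)) (z : ℤ),
      (((g : Equiv.Perm ℤ) ((z : ZMod (2 * n)).val : ℤ) : ℤ) : ZMod (2 * n))
        = ((g : Equiv.Perm ℤ) z : ℤ) := fun g z =>
    affineA_intCast_congr g (by simp)
  { toFun := fun g =>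
      { toFun := fun k => (((g : Equiv.Perm ℤ) (k.val : ℤ) : ℤ) : ZMod (2 * n))
        invFun := fun k => (((g⁻¹ : affineA (2 * n)) : Equiv.Perm ℤ) (k.val : ℤ) : ℤ)
        left_inv := fun k => by
          obtain ⟨z, rfl⟩ := ZMod.intCast_surjective k
          simp only [key]; simp
        right_inv := fun k => by
          obtain ⟨z, rfl⟩ := ZMod.intCast_surjective k
          simp only [key]; simp }
    map_one' := by ext k; simp
    map_mul' := fun g h => by
      ext k
      obtain ⟨z, rfl⟩ := ZMod.intCast_surjective k
      simp only [Equiv.coe_fn_mk, Equiv.Perm.mul_apply, key]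
      simp }

theorem residuePerm_intCast [NeZero n] (g : affineA (2 * n)) (z : ℤ) :
    residuePerm n g (z : ZMod (2 * n)) = ((g : Equiv.Perm ℤ) z : ℤ) :=
  affineA_intCast_congr g (by simp)

end Residues

/-! ### Reflections of type `Ã` as periodic transpositions -/

section Transpositions

variable {n : ℕ}

/-- `r` is the periodic transposition exchanging `i + 2nk` and `j + 2nk` for all `k`. -/
structure IsTransposition (r : affineA (2 * n)) (i j : ℤ) : Prop where
  ne : (i : ZMod (2 * n)) ≠ j
  left : (r : Equiv.Perm ℤ) i = j
  right : (r : Equiv.Perm ℤ) j = i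
  fixed : ∀ z : ℤ, (z : ZMod (2 * n)) ≠ i → (z : ZMod (2 * n)) ≠ j → (r : Equiv.Perm ℤ) z = z

namespace IsTransposition

variable {r r' : affineA (2 * n)} {i j : ℤ}

theorem symm (h : IsTransposition r i j) : IsTransposition r j i :=
  ⟨h.ne.symm, h.right, h.left, fun z h1 h2 => h.fixed z h2 h1⟩

theorem apply_add_mul (h : IsTransposition r i j) (k : ℤ) :
    (r : Equiv.Perm ℤ) (i + k * ((2 * n : ℕ) : ℤ)) = j + k * ((2 * n : ℕ) : ℤ) := by
  rw [affineA_add_mul, h.left]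

theorem conj (h : IsTransposition r i j) (g : affineA (2 * n)) :
    IsTransposition (g * r * g⁻¹) ((g : Equiv.Perm ℤ) i) ((g : Equiv.Perm ℤ) j) := by
  refine ⟨fun h' => h.ne ((affineA_intCast_inj g).1 h'), by simp [h.left], by simp [h.right], ?_⟩
  intro z h1 h2
  obtain ⟨y, rfl⟩ := (g : Equiv.Perm ℤ).surjective z
  rw [ne_eq, affineA_intCast_inj] at h1 h2
  simp [h.fixed y h1 h2]

theorem ext (h : IsTransposition r i j) (h' : IsTransposition r' i j) : r = r' := by
  apply Subtype.ext
  ext z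
  by_cases h1 : (z : ZMod (2 * n)) = i
  · obtain ⟨k, rfl⟩ := intCast_eq_iff.1 h1
    rw [h.apply_add_mul, h'.apply_add_mul]
  by_cases h2 : (z : ZMod (2 * n)) = j
  · obtain ⟨k, rfl⟩ := intCast_eq_iff.1 h2
    rw [h.symm.apply_add_mul, h'.symm.apply_add_mul]
  rw [h.fixed z h1 h2, h'.fixed z h1 h2]

theorem mul_self (h : IsTransposition r i j) : r * r = 1 := by
  apply Subtype.ext
  ext z
  simp only [Subgroup.coe_mul, Equiv.Perm.mul_apply, Subgroup.coe_one, Equiv.Perm.one_apply]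
  by_cases h1 : (z : ZMod (2 * n)) = i
  · obtain ⟨k, rfl⟩ := intCast_eq_iff.1 h1
    rw [h.apply_add_mul, h.symm.apply_add_mul]
  by_cases h2 : (z : ZMod (2 * n)) = j
  · obtain ⟨k, rfl⟩ := intCast_eq_iff.1 h2
    rw [h.symm.apply_add_mul, h.apply_add_mul]
  rw [h.fixed z h1 h2, h.fixed z h1 h2]

theorem inv_eq (h : IsTransposition r i j) : r⁻¹ = r := inv_eq_of_mul_eq_one_left h.mul_self

/-- Conjugation by `z ↦ 1 - z`. -/
theorem apply_one_sub (h : IsTransposition r i j) (h' : IsTransposition r' (1 - i) (1 - j))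
    (z : ℤ) : (r : Equiv.Perm ℤ) (1 - z) = 1 - (r' : Equiv.Perm ℤ) z := by
  by_cases h1 : (z : ZMod (2 * n)) = ((1 - i : ℤ) : ZMod (2 * n))
  · obtain ⟨k, rfl⟩ := intCast_eq_iff.1 h1
    rw [h'.apply_add_mul, show 1 - (1 - i + k * ((2 * n : ℕ) : ℤ)) = i + (-k) * ((2 * n : ℕ) : ℤ)
      by ring, h.apply_add_mul]
    ring
  by_cases h2 : (z : ZMod (2 * n)) = ((1 - j : ℤ) : ZMod (2 * n))
  · obtain ⟨k, rfl⟩ := intCast_eq_iff.1 h2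
    rw [h'.symm.apply_add_mul,
      show 1 - (1 - j + k * ((2 * n : ℕ) : ℤ)) = j + (-k) * ((2 * n : ℕ) : ℤ) by ring,
      h.symm.apply_add_mul]
    ring
  rw [h'.fixed z h1 h2, h.fixed]
  · intro h3
    apply h1
    push_cast at h3 ⊢
    rw [← h3]; ring
  · intro h3
    apply h2
    push_cast at h3 ⊢
    rw [← h3]; ring

end IsTransposition

theorem isTransposition_s {i j : ℤ} (h : (j : ZMod (2 * n)) = i) :
    IsTransposition (s n i) j (j + 1) := by
  have h1 := intCast_eq_iff_dvd.1 h
  refine ⟨fun h => ?_, swapFun_of_dvd h1, ?_, ?_⟩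
  · have := emod_two_eq_of_intCast_eq h
    omega
  · refine (swapFun_of_dvd' (by rwa [show j + 1 - (i + 1) = j - i by ring])).trans (by ring)
  · intro z hz hz'
    refine (if_neg fun hd => hz ?_).trans (if_neg fun hd => hz' ?_)
    · rw [h]; exact intCast_eq_iff_dvd.2 hd
    · push_cast
      rw [h]
      have := intCast_eq_iff_dvd.2 hd
      push_cast at this
      exact this

theorem exists_isTransposition_of_mem {r : affineA (2 * n)} (h : r ∈ reflectionsA n) :
    ∃ i j, IsTransposition r i j := by
  obtain ⟨g, i, rfl⟩ := h
  exact ⟨_, _, (isTransposition_s (i := i) rfl).conj g⟩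

theorem conj_mem_reflectionsA {r : affineA (2 * n)} (h : r ∈ reflectionsA n)
    (g : affineA (2 * n)) : g * r * g⁻¹ ∈ reflectionsA n := by
  obtain ⟨k, i, rfl⟩ := h
  exact ⟨g * k, i, by group⟩

theorem s_mem_reflectionsA (i : ℤ) : s n i ∈ reflectionsA n := ⟨1, i, by simp⟩

/-- Conjugating by the simple reflection that exchanges `j - 1` and `j` shortens the distance. It
may also move `i` to `i + 1`, when `i` and `j - 1` are congruent, which only brings the points
closer. -/
theorem exists_isTransposition_of_lt (d : ℕ) : ∀ i j : ℤ, j = i + d →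
    (i : ZMod (2 * n)) ≠ j → ∃ r ∈ reflectionsA n, IsTransposition r i j := by
  induction d using Nat.strong_induction_on with
  | _ d ih =>
    intro i j hj hij
    have hd0 : d ≠ 0 := by
      rintro rfl
      simp [hj] at hij
    by_cases hd1 : d = 1
    · subst hd1 hj
      exact ⟨s n i, s_mem_reflectionsA i, by simpa using isTransposition_s (i := i) rfl⟩
    have hs := isTransposition_s (n := n) (i := j - 1) rfl
    rw [sub_add_cancel] at hs
    have hmain : ∀ i' : ℤ, ((s n (j - 1) : affineA (2 * n)) : Equiv.Perm ℤ) i = i' →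
        (i' = i ∨ i' = i + 1) → ∃ r ∈ reflectionsA n, IsTransposition r i j := by
      intro i' hi' hor
      have hne : (i' : ZMod (2 * n)) ≠ ((j - 1 : ℤ) : ZMod (2 * n)) := by
        have := (affineA_intCast_inj (s n (j - 1))).not.2 hij
        rwa [hi', hs.right] at this
      have hlt : i' < j - 1 := by
        rcases hor with rfl | rfl
        · omega
        · rcases lt_or_eq_of_le (show i + 1 ≤ j - 1 by omega) with h | h
          · exact h
          · rw [h] at hne; exact absurd rfl hne
      obtain ⟨r, hr, ht⟩ := ih (j - 1 - i').toNat (by omega) i' (j - 1) (by omega) hne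
      refine ⟨_, conj_mem_reflectionsA hr (s n (j - 1)), ?_⟩
      have := ht.conj (s n (j - 1))
      rw [hs.left, ← hi'] at this
      rwa [← Equiv.Perm.mul_apply, ← Subgroup.coe_mul, hs.mul_self] at this
    by_cases hi : (i : ZMod (2 * n)) = ((j - 1 : ℤ) : ZMod (2 * n))
    · exact hmain (i + 1) (isTransposition_s hi).left (Or.inr rfl)
    · exact hmain i (hs.fixed i hi hij) (Or.inl rfl)

theorem exists_isTransposition {i j : ℤ} (h : (i : ZMod (2 * n)) ≠ j) :
    ∃ r ∈ reflectionsA n, IsTransposition r i j := by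
  rcases le_total i j with hij | hij
  · exact exists_isTransposition_of_lt (j - i).toNat i j (by omega) h
  · obtain ⟨r, hr, ht⟩ := exists_isTransposition_of_lt (i - j).toNat j i (by omega) h.symm
    exact ⟨r, hr, ht.symm⟩

theorem IsTransposition.mem_reflectionsA {r : affineA (2 * n)} {i j : ℤ}
    (h : IsTransposition r i j) : r ∈ reflectionsA n := by
  obtain ⟨r', hr', h'⟩ := exists_isTransposition h.ne
  rwa [h.ext h']

theorem sign_residuePerm [NeZero n] {r : affineA (2 * n)} (h : r ∈ reflectionsA n) :
    Equiv.Perm.sign (residuePerm n r) = -1 := by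
  obtain ⟨i, j, h⟩ := exists_isTransposition_of_mem h
  have : residuePerm n r = Equiv.swap (i : ZMod (2 * n)) (j : ZMod (2 * n)) := by
    ext k
    obtain ⟨z, rfl⟩ := ZMod.intCast_surjective k
    rw [residuePerm_intCast]
    by_cases h1 : (z : ZMod (2 * n)) = i
    · rw [affineA_intCast_congr r h1, h.left, h1, Equiv.swap_apply_left]
    by_cases h2 : (z : ZMod (2 * n)) = j
    · rw [affineA_intCast_congr r h2, h.right, h2, Equiv.swap_apply_right]
    rw [h.fixed z h1 h2, Equiv.swap_apply_of_ne_of_ne h1 h2]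
  rw [this, Equiv.Perm.sign_swap h.ne]

end Transpositions

/-! ### Expressions and lengths -/

section GenLength

variable {G : Type*} [Group G] {S : Set G}

/-- `g` is a product of `k` elements of `S`. -/
def HasExpr (S : Set G) (g : G) (k : ℕ) : Prop :=
  ∃ L : List G, L.length = k ∧ (∀ x ∈ L, x ∈ S) ∧ L.prod = g

theorem HasExpr.genLength_le {g : G} {k : ℕ} (h : HasExpr S g k) : genLength S g ≤ k :=
  Nat.sInf_le h

/-- An infimum over an empty set of naturals is `0`, so `genLength` is meaningful only once some
expression is known. This is why generation by reflections has to be proved below. -/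
theorem HasExpr.hasExpr_genLength {g : G} {k : ℕ} (h : HasExpr S g k) :
    HasExpr S g (genLength S g) :=
  Nat.sInf_mem (s := {k | HasExpr S g k}) ⟨k, h⟩

theorem hasExpr_one : HasExpr S 1 0 := ⟨[], rfl, by simp, rfl⟩

theorem hasExpr_of_mem {g : G} (h : g ∈ S) : HasExpr S g 1 := ⟨[g], rfl, by simpa using h, by simp⟩

theorem HasExpr.mul {g h : G} {k l : ℕ} (hg : HasExpr S g k) (hh : HasExpr S h l) :
    HasExpr S (g * h) (k + l) := by
  obtain ⟨L, rfl, hL, rfl⟩ := hg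
  obtain ⟨M, rfl, hM, rfl⟩ := hh
  exact ⟨L ++ M, by simp, fun x hx => (List.mem_append.1 hx).elim (hL x) (hM x), by simp⟩

theorem HasExpr.genLength_mul_le {g h : G} {k l : ℕ} (hg : HasExpr S g k) (hh : HasExpr S h l) :
    genLength S (g * h) ≤ genLength S g + genLength S h :=
  (hg.hasExpr_genLength.mul hh.hasExpr_genLength).genLength_le

end GenLength

/-! ### Transitivity of the factors of the Coxeter element -/

section Constant

variable {n : ℕ}

theorem list_prod_invariant {α : Type*} {x : ℤ → α} {L : List (affineA (2 * n))}
    (h : ∀ r ∈ L, ∀ z, x ((r : Equiv.Perm ℤ) z) = x z) (z : ℤ) :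
    x ((L.prod : Equiv.Perm ℤ) z) = x z := by
  induction L with
  | nil => simp
  | cons r L ih =>
    rw [List.prod_cons, Subgroup.coe_mul, Equiv.Perm.mul_apply, h r (by simp),
      ih fun t ht => h t (by simp [ht])]

/-- A product of parity preserving reflections can be restricted to the odd integers. -/
theorem exists_restrict_odd {L : List (affineA (2 * n))} (hL : ∀ r ∈ L, r ∈ reflectionsA n)
    (h : ∀ r ∈ L, ∀ z : ℤ, (r : Equiv.Perm ℤ) z % 2 = z % 2) :
    ∃ g : affineA (2 * n), ∀ z : ℤ,
      (z % 2 = 1 → (g : Equiv.Perm ℤ) z = (L.prod : Equiv.Perm ℤ) z) ∧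
      (z % 2 = 0 → (g : Equiv.Perm ℤ) z = z) := by
  induction L with
  | nil => exact ⟨1, by simp⟩
  | cons r L ih =>
    obtain ⟨g, hg⟩ := ih (fun t ht => hL t (by simp [ht])) (fun t ht => h t (by simp [ht]))
    obtain ⟨i, j, ht⟩ := exists_isTransposition_of_mem (hL r (by simp))
    have hij : j % 2 = i % 2 := by rw [← h r (by simp) i, ht.left]
    have hfix : ∀ z : ℤ, z % 2 ≠ i % 2 → (r : Equiv.Perm ℤ) z = z := fun z hz =>
      ht.fixed z (fun e => hz (emod_two_eq_of_intCast_eq e))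
        (fun e => hz ((emod_two_eq_of_intCast_eq e).trans hij))
    have hpar : ∀ z : ℤ, (L.prod : Equiv.Perm ℤ) z % 2 = z % 2 :=
      list_prod_invariant (x := fun z : ℤ => z % 2) (fun t ht => h t (by simp [ht]))
    -- A parity-preserving transposition acts on even integers only or on odd integers only: the
    -- former are dropped, the latter kept. The result lies in `affineA` by construction, so its
    -- total shift is `0`.
    rcases Int.emod_two_eq_zero_or_one i with hi | hi
    · refine ⟨g, fun z => ⟨fun hz => ?_, (hg z).2⟩⟩
      rw [List.prod_cons, Subgroup.coe_mul, Equiv.Perm.mul_apply, hfix _ (by rw [hpar]; omega),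
        (hg z).1 hz]
    · refine ⟨r * g, fun z => ⟨fun hz => ?_, fun hz => ?_⟩⟩
      · rw [List.prod_cons, Subgroup.coe_mul, Subgroup.coe_mul, Equiv.Perm.mul_apply,
          Equiv.Perm.mul_apply, (hg z).1 hz]
      · rw [Subgroup.coe_mul, Equiv.Perm.mul_apply, (hg z).2 hz, hfix z (by omega)]

/-- The reflections of a factorization of the Coxeter element act transitively on `ℤ`. -/
theorem constant_of_prod_eq_coxA (hn : 1 ≤ n) {α : Type*} {x : ℤ → α} {L : List (affineA (2 * n))}
    (hL : ∀ r ∈ L, r ∈ reflectionsA n) (hc : L.prod = coxA n)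
    (h : ∀ r ∈ L, ∀ z, x ((r : Equiv.Perm ℤ) z) = x z) (z : ℤ) : x z = x 0 := by
  have hcx : ∀ z, x ((coxA n : Equiv.Perm ℤ) z) = x z := hc ▸ list_prod_invariant h
  have hodd : ∀ k : ℤ, x (2 * k + 1) = x 1 := by
    intro k
    induction k using Int.induction_on with
    | zero => rfl
    | succ k ih =>
      rw [← ih, ← hcx (2 * k + 1), coxA_apply hn, if_pos (by omega)]
      congr 1
    | pred k ih =>
      rw [← ih, ← hcx (2 * (-k - 1) + 1), coxA_apply hn, if_pos (by omega)]
      congr 1; ring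
  have heven : ∀ k : ℤ, x (2 * k) = x 0 := by
    intro k
    induction k using Int.induction_on with
    | zero => rfl
    | succ k ih =>
      rw [← ih, ← hcx (2 * (k + 1)), coxA_apply hn, if_neg (by omega)]
      congr 1; ring
    | pred k ih =>
      rw [← ih, ← hcx (2 * (-k)), coxA_apply hn, if_neg (by omega)]
      congr 1; ring
  have hall : ∀ z : ℤ, (z % 2 = 1 → x z = x 1) ∧ (z % 2 = 0 → x z = x 0) := fun z =>
    ⟨fun hz => by rw [← hodd (z / 2)]; congr 1; omega,
      fun hz => by rw [← heven (z / 2)]; congr 1; omega⟩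
  by_cases h10 : x 1 = x 0
  · rcases Int.emod_two_eq_zero_or_one z with hz | hz
    · exact (hall z).2 hz
    · rw [(hall z).1 hz, h10]
  -- If `x` separates the two parity classes, every factor preserves parity. The restriction of the
  -- product to the odd integers then has total shift `0`, whereas `c` moves each odd integer by
  -- `+2`.
  exfalso
  have hpar : ∀ r ∈ L, ∀ z : ℤ, (r : Equiv.Perm ℤ) z % 2 = z % 2 := by
    intro r hr z
    have hx := h r hr z
    rcases Int.emod_two_eq_zero_or_one z with hz | hz <;>
    rcases Int.emod_two_eq_zero_or_one ((r : Equiv.Perm ℤ) z) with hz' | hz'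
    · omega
    · rw [(hall _).1 hz', (hall _).2 hz] at hx
      exact absurd hx h10
    · rw [(hall _).2 hz', (hall _).1 hz] at hx
      exact absurd hx.symm h10
    · omega
  obtain ⟨g, hg⟩ := exists_restrict_odd hL hpar
  have hsum : shiftSum (2 * n) (g : Equiv.Perm ℤ) = 0 := g.2.2
  have hpos : 0 < shiftSum (2 * n) (g : Equiv.Perm ℤ) := by
    refine Finset.sum_pos' (fun y _ => ?_) ⟨1, ?_, ?_⟩
    · rcases Int.emod_two_eq_zero_or_one y with hy | hy
      · rw [(hg y).2 hy]; omega
      · rw [(hg y).1 hy, hc, coxA_apply hn, if_pos hy]; omega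
    · rw [Finset.mem_Icc]; omega
    · rw [(hg 1).1 rfl, hc, coxA_apply hn]; decide
  omega

end Constant

/-! ### Invariant quasi-periodic functions and lower bounds for the length -/

section QuasiPeriodic

variable {n : ℕ}

/-- Functions `x : ℤ → ℚ` for which `x (z + 2n) - x z` does not depend on `z`, given by the
values on a period and the increment. -/
abbrev QuasiPeriodic (n : ℕ) : Type := (ZMod (2 * n) → ℚ) × ℚ

/-- The value at `z` of a quasi-periodic function. -/
def ev (n : ℕ) (z : ℤ) : QuasiPeriodic n →ₗ[ℚ] ℚ :=
  (LinearMap.proj (z : ZMod (2 * n))).comp (LinearMap.fst ℚ _ _) +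
    ((z / ((2 * n : ℕ) : ℤ) : ℤ) : ℚ) • LinearMap.snd ℚ _ _

theorem ev_apply (z : ℤ) (v : QuasiPeriodic n) :
    ev n z v = v.1 (z : ZMod (2 * n)) + ((z / ((2 * n : ℕ) : ℤ) : ℤ) : ℚ) * v.2 := by
  simp [ev]

theorem two_mul_cast_ne_zero [NeZero n] : ((2 * n : ℕ) : ℤ) ≠ 0 := by
  exact_mod_cast NeZero.ne (2 * n)

theorem ev_add_mul [NeZero n] (z k : ℤ) (v : QuasiPeriodic n) :
    ev n (z + k * ((2 * n : ℕ) : ℤ)) v = ev n z v + k * v.2 := by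
  rw [ev_apply, ev_apply, intCast_add_mul, Int.add_mul_ediv_right _ _ two_mul_cast_ne_zero]
  push_cast
  ring

theorem exists_ev_eq [NeZero n] {x : ℤ → ℚ} {l : ℚ}
    (h : ∀ z, x (z + ((2 * n : ℕ) : ℤ)) = x z + l) :
    ∃ v : QuasiPeriodic n, v.2 = l ∧ ∀ z, ev n z v = x z := by
  have hk : ∀ z k : ℤ, x (z + k * ((2 * n : ℕ) : ℤ)) = x z + k * l := by
    intro z k
    induction k using Int.induction_on with
    | zero => simp
    | succ k ih =>
      rw [show z + ((k : ℤ) + 1) * ((2 * n : ℕ) : ℤ)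
        = z + k * ((2 * n : ℕ) : ℤ) + ((2 * n : ℕ) : ℤ) by ring, h, ih]
      push_cast; ring
    | pred k ih =>
      have := h (z + (-(k : ℤ) - 1) * ((2 * n : ℕ) : ℤ))
      rw [show z + (-(k : ℤ) - 1) * ((2 * n : ℕ) : ℤ) + ((2 * n : ℕ) : ℤ)
        = z + -k * ((2 * n : ℕ) : ℤ) by ring, ih] at this
      push_cast at this ⊢; linarith
  refine ⟨(fun k => x k.val, l), rfl, fun z => ?_⟩
  rw [ev_apply]
  simp only [ZMod.val_intCast]
  rw [← hk]
  congr 1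
  exact Int.emod_add_ediv_mul z _

theorem finrank_quasiPeriodic [NeZero n] : Module.finrank ℚ (QuasiPeriodic n) = 2 * n + 1 := by
  simp [ZMod.card]

/-- The quasi-periodic functions invariant under `g`. -/
def fixedSpace (g : affineA (2 * n)) : Submodule ℚ (QuasiPeriodic n) where
  carrier := {v | ∀ z : ℤ, ev n ((g : Equiv.Perm ℤ) z) v = ev n z v}
  add_mem' := fun h h' z => by rw [map_add, map_add, h, h']
  zero_mem' := fun z => by simp
  smul_mem' := fun a v h z => by rw [map_smul, map_smul, h]

/-- The quasi-periodic functions invariant under all elements of `L`. -/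
def fixedSpaceList (L : List (affineA (2 * n))) : Submodule ℚ (QuasiPeriodic n) where
  carrier := {v | ∀ r ∈ L, v ∈ fixedSpace r}
  add_mem' := fun h h' r hr => add_mem (h r hr) (h' r hr)
  zero_mem' := fun _ _ => zero_mem _
  smul_mem' := fun a _ h r hr => Submodule.smul_mem _ a (h r hr)

theorem mem_fixedSpaceList {L : List (affineA (2 * n))} {v : QuasiPeriodic n} :
    v ∈ fixedSpaceList L ↔ ∀ r ∈ L, v ∈ fixedSpace r := Iff.rfl

theorem mem_fixedSpace_mul {g h : affineA (2 * n)} {v : QuasiPeriodic n}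
    (hg : v ∈ fixedSpace g) (hh : v ∈ fixedSpace h) : v ∈ fixedSpace (g * h) := fun z => by
  rw [Subgroup.coe_mul, Equiv.Perm.mul_apply, hg, hh]

theorem fixedSpaceList_le (L : List (affineA (2 * n))) :
    fixedSpaceList L ≤ fixedSpace L.prod := fun v hv z =>
  list_prod_invariant (x := fun z => ev n z v) (fun r hr => hv r hr) z

theorem IsTransposition.mem_fixedSpace_iff [NeZero n] {r : affineA (2 * n)} {i j : ℤ}
    (h : IsTransposition r i j) {v : QuasiPeriodic n} :
    v ∈ fixedSpace r ↔ (ev n i - ev n j) v = 0 := by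
  rw [LinearMap.sub_apply, sub_eq_zero]
  constructor
  · intro hv
    have := hv i
    rw [h.left] at this
    exact this.symm
  · intro hv z
    by_cases h1 : (z : ZMod (2 * n)) = i
    · obtain ⟨k, rfl⟩ := intCast_eq_iff.1 h1
      rw [h.apply_add_mul, ev_add_mul, ev_add_mul, hv]
    by_cases h2 : (z : ZMod (2 * n)) = j
    · obtain ⟨k, rfl⟩ := intCast_eq_iff.1 h2
      rw [h.symm.apply_add_mul, ev_add_mul, ev_add_mul, hv]
    rw [h.fixed z h1 h2]

theorem finrank_le_finrank_inf_ker {E : Type*} [AddCommGroup E] [Module ℚ E]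
    [FiniteDimensional ℚ E] (W : Submodule ℚ E) (f : E →ₗ[ℚ] ℚ) :
    Module.finrank ℚ W ≤ Module.finrank ℚ ↥(W ⊓ LinearMap.ker f) + 1 := by
  have h1 := Submodule.finrank_sup_add_finrank_inf_eq W (LinearMap.ker f)
  have h2 := LinearMap.finrank_range_add_finrank_ker f
  have h3 := Submodule.finrank_le (W ⊔ LinearMap.ker f)
  have h4 := Submodule.finrank_le (LinearMap.range f)
  rw [Module.finrank_self] at h4
  omega

theorem finrank_le_finrank_inf_fixedSpace [NeZero n] (W : Submodule ℚ (QuasiPeriodic n))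
    {r : affineA (2 * n)} (hr : r ∈ reflectionsA n) :
    Module.finrank ℚ W ≤ Module.finrank ℚ ↥(W ⊓ fixedSpace r) + 1 := by
  obtain ⟨i, j, h⟩ := exists_isTransposition_of_mem hr
  have : fixedSpace r = LinearMap.ker (ev n i - ev n j) := by
    ext v; rw [h.mem_fixedSpace_iff, LinearMap.mem_ker]
  rw [this]
  exact finrank_le_finrank_inf_ker W _

/-- Each reflection imposes a single linear equation on a space of dimension `2n + 1`. -/
theorem le_finrank_fixedSpaceList [NeZero n] {L : List (affineA (2 * n))}
    (hL : ∀ r ∈ L, r ∈ reflectionsA n) :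
    2 * n + 1 ≤ Module.finrank ℚ (fixedSpaceList L) + L.length := by
  induction L with
  | nil =>
    have : fixedSpaceList ([] : List (affineA (2 * n))) = ⊤ :=
      eq_top_iff.2 fun v _ r hr => by simp at hr
    rw [this, finrank_top, finrank_quasiPeriodic]
    simp
  | cons r L ih =>
    have h1 := ih fun t ht => hL t (by simp [ht])
    have h2 := finrank_le_finrank_inf_fixedSpace (fixedSpaceList L) (hL r (by simp))
    have h3 : fixedSpaceList (r :: L) = fixedSpaceList L ⊓ fixedSpace r := by
      ext v
      simp only [Submodule.mem_inf, mem_fixedSpaceList, List.forall_mem_cons]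
      exact and_comm
    rw [h3, List.length_cons]
    omega

/-- A subspace all of whose members are constant functions has dimension at most one. -/
theorem finrank_le_one_of_constant [NeZero n] {W : Submodule ℚ (QuasiPeriodic n)}
    (h : ∀ v ∈ W, ∀ z, ev n z v = ev n 0 v) : Module.finrank ℚ W ≤ 1 := by
  have hinj : Function.Injective ((ev n 0).comp W.subtype) := by
    rw [← LinearMap.ker_eq_bot, LinearMap.ker_eq_bot']
    rintro ⟨v, hv⟩ h0
    have h0' : ev n 0 v = 0 := h0
    have hz : ∀ z, ev n z v = 0 := fun z => (h v hv z).trans h0'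
    have h2 : v.2 = 0 := by
      have h3 := ev_add_mul 0 1 v
      rw [hz, hz] at h3
      simpa using h3.symm
    apply Subtype.ext
    refine Prod.ext (funext fun k => ?_) h2
    obtain ⟨z, rfl⟩ := ZMod.intCast_surjective k
    have h3 := hz z
    rw [ev_apply, h2, mul_zero, add_zero] at h3
    exact h3
  have := LinearMap.finrank_le_finrank_of_injective hinj
  rwa [Module.finrank_self] at this

theorem le_length_of_prod_eq_coxA [NeZero n] {L : List (affineA (2 * n))}
    (hL : ∀ r ∈ L, r ∈ reflectionsA n) (hc : L.prod = coxA n) : 2 * n ≤ L.length := by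
  have h1 := le_finrank_fixedSpaceList hL
  have h2 := finrank_le_one_of_constant (W := fixedSpaceList L) fun v hv z =>
    constant_of_prod_eq_coxA (x := fun z => ev n z v) NeZero.one_le hL hc (fun r hr => hv r hr) z
  omega

theorem hasExpr_coxA (n : ℕ) : HasExpr (reflectionsA n) (coxA n) (2 * n) := by
  refine ⟨(List.range n).map (fun j : ℕ => s n (2 * j + 2)) ++
    (List.range n).map (fun j : ℕ => s n (2 * j + 1)), by simp; ring, ?_, by
      rw [List.prod_append, coxA]⟩
  intro x hx
  rw [List.mem_append, List.mem_map, List.mem_map] at hx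
  rcases hx with ⟨j, -, rfl⟩ | ⟨j, -, rfl⟩ <;> exact s_mem_reflectionsA _

theorem genLength_coxA [NeZero n] : genLength (reflectionsA n) (coxA n) = 2 * n := by
  apply le_antisymm (hasExpr_coxA n).genLength_le
  obtain ⟨L, hk, hL, hc⟩ := (hasExpr_coxA n).hasExpr_genLength
  rw [← hk]
  exact le_length_of_prod_eq_coxA hL hc

theorem HasExpr.le_finrank_fixedSpace [NeZero n] {g : affineA (2 * n)} {k : ℕ}
    (h : HasExpr (reflectionsA n) g k) :
    2 * n + 1 ≤ Module.finrank ℚ (fixedSpace g) + k := by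
  obtain ⟨L, rfl, hL, rfl⟩ := h
  have h1 := le_finrank_fixedSpaceList hL
  have h2 := Submodule.finrank_mono (fixedSpaceList_le L)
  omega

theorem HasExpr.sign_residuePerm [NeZero n] {g : affineA (2 * n)} {k : ℕ}
    (h : HasExpr (reflectionsA n) g k) :
    Equiv.Perm.sign (residuePerm n g) = (-1) ^ k := by
  obtain ⟨L, rfl, hL, rfl⟩ := h
  induction L with
  | nil => simp
  | cons r L ih =>
    rw [List.prod_cons, map_mul, map_mul, ih fun t ht => hL t (by simp [ht]),
      DualCTilde.sign_residuePerm (hL r (by simp)), List.length_cons, pow_succ']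

theorem even_add_iff_of_neg_one_pow_eq {k l : ℕ} (h : (-1 : ℤˣ) ^ k = (-1) ^ l) :
    Even (k + l) := by
  by_contra hodd
  rw [Nat.not_even_iff_odd] at hodd
  have h1 : (-1 : ℤˣ) ^ (k + l) = -1 := hodd.neg_one_pow
  rw [pow_add, h, ← pow_add, Even.neg_one_pow ⟨l, rfl⟩] at h1
  exact absurd h1 (by decide)

/-- The sign of the induced permutation of residues fixes the parity of every expression. Below,
this turns dimension inequalities into equalities. -/
theorem HasExpr.even_add [NeZero n] {g : affineA (2 * n)} {k l : ℕ}
    (h : HasExpr (reflectionsA n) g k) (h' : HasExpr (reflectionsA n) g l) : Even (k + l) :=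
  even_add_iff_of_neg_one_pow_eq (h.sign_residuePerm.symm.trans h'.sign_residuePerm)

end QuasiPeriodic

/-! ### Elliptic elements: length equals codimension -/

section Elliptic

variable {n : ℕ} {g : affineA (2 * n)}

/-- `g` fixes a quasi-periodic function with non-zero increment; equivalently, `g` has finite
order. -/
def IsElliptic (g : affineA (2 * n)) : Prop := ∃ v ∈ fixedSpace g, v.2 ≠ 0

theorem IsElliptic.of_le {h : affineA (2 * n)} (hg : IsElliptic g)
    (hle : fixedSpace g ≤ fixedSpace h) : IsElliptic h := by
  obtain ⟨v, hv, h0⟩ := hg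
  exact ⟨v, hle hv, h0⟩

theorem fixedSpace_le_pow (g : affineA (2 * n)) (p : ℕ) : fixedSpace g ≤ fixedSpace (g ^ p) := by
  intro v hv
  induction p with
  | zero => rw [pow_zero]; exact fun z => rfl
  | succ p ih => rw [pow_succ]; exact mem_fixedSpace_mul ih hv

/-- A translation of `z` by `2nk` would change an invariant function by `k` times its non-zero
increment. -/
theorem IsElliptic.apply_eq_self [NeZero n] (hg : IsElliptic g) {z : ℤ}
    (h : (((g : Equiv.Perm ℤ) z : ℤ) : ZMod (2 * n)) = z) : (g : Equiv.Perm ℤ) z = z := by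
  obtain ⟨v, hv, h0⟩ := hg
  obtain ⟨k, hk⟩ := intCast_eq_iff.1 h
  have h1 := hv z
  rw [hk, ev_add_mul] at h1
  have h2 : (k : ℚ) = 0 := by
    rcases mul_eq_zero.1 (show (k : ℚ) * v.2 = 0 by linarith) with h | h
    · exact h
    · exact absurd h h0
  have h3 : k = 0 := by exact_mod_cast h2
  rw [hk, h3]; ring

theorem IsTransposition.fixedSpace_le [NeZero n] {r : affineA (2 * n)} {i : ℤ}
    (h : IsTransposition r i ((g : Equiv.Perm ℤ) i)) : fixedSpace g ≤ fixedSpace r := by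
  intro v hv
  rw [h.mem_fixedSpace_iff, LinearMap.sub_apply, hv i, sub_self]

theorem fixedSpace_le_mul {r : affineA (2 * n)} (h : fixedSpace g ≤ fixedSpace r) :
    fixedSpace g ≤ fixedSpace (r * g) := fun _ hv => mem_fixedSpace_mul (h hv) hv

theorem fixedSpace_one : fixedSpace (1 : affineA (2 * n)) = ⊤ := eq_top_iff.2 fun _ _ _ => rfl

theorem inf_fixedSpace_mul_le {r : affineA (2 * n)} (hr : r * r = 1) :
    fixedSpace (r * g) ⊓ fixedSpace r ≤ fixedSpace g := by
  intro v hv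
  have := mem_fixedSpace_mul hv.2 hv.1
  rwa [← mul_assoc, hr, one_mul] at this

/-- The indicator function of the residue class of `i`, with increment `0`, is invariant under `h`
but not under `g`. -/
theorem fixedSpace_lt_of_fixes [NeZero n] {h : affineA (2 * n)} {i : ℤ}
    (hle : fixedSpace g ≤ fixedSpace h)
    (hg : (((g : Equiv.Perm ℤ) i : ℤ) : ZMod (2 * n)) ≠ i) (hh : (h : Equiv.Perm ℤ) i = i) :
    fixedSpace g < fixedSpace h := by
  refine lt_of_le_not_ge hle fun hge => ?_
  have hev : ∀ z : ℤ, ev n z (Pi.single (i : ZMod (2 * n)) 1, 0)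
      = if (z : ZMod (2 * n)) = i then 1 else 0 := by
    intro z
    rw [ev_apply, mul_zero, add_zero]
    exact Pi.single_apply _ _ _
  have hmem : ((Pi.single (i : ZMod (2 * n)) 1, 0) : QuasiPeriodic n) ∈ fixedSpace h := by
    intro z
    rw [hev, hev]
    congr 1
    have := affineA_intCast_inj h (z := z) (w := i)
    rw [hh] at this
    exact propext this
  have := hge hmem i
  rw [hev, hev, if_neg hg, if_pos rfl] at this
  exact zero_ne_one this

theorem exists_apply_ne (h : g ≠ 1) : ∃ i, (g : Equiv.Perm ℤ) i ≠ i := by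
  by_contra hcon
  push Not at hcon
  exact h (Subtype.ext (Equiv.ext hcon))

/-- For a moved point `i`, let `r` exchange `i` and `g i`. Then `r * g` is still elliptic and fixes
`i`, and its invariant space is larger by exactly one dimension. -/
theorem IsElliptic.hasExpr [NeZero n] {m : ℕ} (hg : IsElliptic g)
    (hm : Module.finrank ℚ (fixedSpace g) + m = 2 * n + 1) :
    HasExpr (reflectionsA n) g m := by
  induction m generalizing g with
  | zero =>
    by_cases h1 : g = 1
    · rw [h1]; exact hasExpr_one
    obtain ⟨i, hi⟩ := exists_apply_ne h1
    have htop : fixedSpace g = ⊤ := Submodule.eq_top_of_finrank_eq (by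
      rw [finrank_quasiPeriodic]; omega)
    have := fixedSpace_lt_of_fixes (g := g) (h := 1) (i := i) (by rw [fixedSpace_one]; exact le_top)
      (fun h => hi (hg.apply_eq_self h)) rfl
    rw [htop] at this
    exact absurd this not_top_lt
  | succ m ih =>
    have h1 : g ≠ 1 := by
      rintro rfl
      rw [fixedSpace_one, finrank_top, finrank_quasiPeriodic] at hm
      omega
    obtain ⟨i, hi⟩ := exists_apply_ne h1
    have hne : (((g : Equiv.Perm ℤ) i : ℤ) : ZMod (2 * n)) ≠ i := fun h => hi (hg.apply_eq_self h)
    obtain ⟨r, hr, ht⟩ := exists_isTransposition hne.symm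
    have hle := fixedSpace_le_mul ht.fixedSpace_le
    have hlt := Submodule.finrank_lt_finrank_of_lt (fixedSpace_lt_of_fixes hle hne (by
      rw [Subgroup.coe_mul, Equiv.Perm.mul_apply, ht.right]))
    have h2 := finrank_le_finrank_inf_fixedSpace (fixedSpace (r * g)) hr
    have h3 := Submodule.finrank_mono (inf_fixedSpace_mul_le (g := g) ht.mul_self)
    have := (hasExpr_of_mem hr).mul (ih (hg.of_le hle) (by omega))
    rwa [← mul_assoc, ht.mul_self, one_mul, add_comm] at this

theorem IsElliptic.exists_hasExpr [NeZero n] (hg : IsElliptic g) :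
    ∃ m, Module.finrank ℚ (fixedSpace g) + m = 2 * n + 1 ∧ HasExpr (reflectionsA n) g m := by
  have h := Submodule.finrank_le (fixedSpace g)
  rw [finrank_quasiPeriodic] at h
  exact ⟨2 * n + 1 - Module.finrank ℚ (fixedSpace g), by omega, hg.hasExpr (by omega)⟩

theorem IsElliptic.genLength_add [NeZero n] (hg : IsElliptic g) :
    genLength (reflectionsA n) g + Module.finrank ℚ (fixedSpace g) = 2 * n + 1 := by
  obtain ⟨m, hm, h⟩ := hg.exists_hasExpr
  have h1 := h.genLength_le
  have h2 := h.hasExpr_genLength.le_finrank_fixedSpace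
  omega

/-- A reflection whose mirror contains the fixed space of an elliptic element divides it. -/
theorem IsElliptic.mul_reflection [NeZero n] (hg : IsElliptic g) {r : affineA (2 * n)}
    (hr : r ∈ reflectionsA n) (hle : fixedSpace g ≤ fixedSpace r) :
    IsElliptic (r * g) ∧
      Module.finrank ℚ (fixedSpace (r * g)) = Module.finrank ℚ (fixedSpace g) + 1 := by
  have hle' := fixedSpace_le_mul hle
  have hell := hg.of_le hle'
  refine ⟨hell, ?_⟩
  obtain ⟨m, hm, h⟩ := hg.exists_hasExpr
  obtain ⟨m', hm', h'⟩ := hell.exists_hasExpr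
  -- The inclusions only show that the dimension grows by `0` or `1`; parity excludes `0`.
  obtain ⟨k, hk⟩ := h'.even_add ((hasExpr_of_mem hr).mul h)
  obtain ⟨i, j, ht⟩ := exists_isTransposition_of_mem hr
  have h1 := Submodule.finrank_mono hle'
  have h2 := finrank_le_finrank_inf_fixedSpace (fixedSpace (r * g)) hr
  have h3 := Submodule.finrank_mono (inf_fixedSpace_mul_le (g := g) ht.mul_self)
  omega

/-- A reflection which makes a non-elliptic element elliptic divides it. -/
theorem IsElliptic.genLength_add_one_le [NeZero n] {r : affineA (2 * n)}
    (hr : r ∈ reflectionsA n) (hell : IsElliptic (r * g)) (hg : ¬ IsElliptic g) :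
    genLength (reflectionsA n) (r * g) + 1 ≤ genLength (reflectionsA n) g := by
  obtain ⟨i, j, ht⟩ := exists_isTransposition_of_mem hr
  obtain ⟨m, hm, h⟩ := hell.exists_hasExpr
  have hexpr := (hasExpr_of_mem hr).mul h
  rw [← mul_assoc, ht.mul_self, one_mul] at hexpr
  have h1 := hexpr.hasExpr_genLength.le_finrank_fixedSpace
  obtain ⟨k, hk⟩ := hexpr.even_add hexpr.hasExpr_genLength
  have h2 := finrank_le_finrank_inf_fixedSpace (fixedSpace g) hr
  -- Strictness comes from the function with non-zero increment, which `r * g` fixes and `g` cannot.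
  -- It gives length of `g` at least that of `r * g`, and parity supplies the missing `1`.
  have hlt : fixedSpace g ⊓ fixedSpace r < fixedSpace (r * g) := by
    refine lt_of_le_of_ne (fun v hv => mem_fixedSpace_mul hv.2 hv.1) fun heq => ?_
    obtain ⟨v, hv, h0⟩ := hell
    rw [← heq] at hv
    exact hg ⟨v, hv.1, h0⟩
  have h3 := Submodule.finrank_lt_finrank_of_lt hlt
  have h4 := h.genLength_le
  omega

theorem pow_apply_of_translate {q : ℕ} {z m : ℤ}
    (h : ((g ^ q : affineA (2 * n)) : Equiv.Perm ℤ) z = z + m * ((2 * n : ℕ) : ℤ)) (k : ℕ) :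
    ((g ^ (q * k) : affineA (2 * n)) : Equiv.Perm ℤ) z
      = z + (k * m) * ((2 * n : ℕ) : ℤ) := by
  induction k with
  | zero => simp
  | succ k ih =>
    rw [mul_add, mul_one, pow_add, Subgroup.coe_mul, Equiv.Perm.mul_apply, h, affineA_add_mul, ih]
    push_cast
    ring

theorem exists_pow_intCast_eq [NeZero n] (g : affineA (2 * n)) :
    ∃ p : ℕ, 0 < p ∧ ∀ z : ℤ,
      ((((g ^ p : affineA (2 * n)) : Equiv.Perm ℤ) z : ℤ) : ZMod (2 * n)) = z := by
  refine ⟨orderOf (residuePerm n g), orderOf_pos _, fun z => ?_⟩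
  rw [← residuePerm_intCast, map_pow, pow_orderOf_eq_one, Equiv.Perm.one_apply]

/-- Summing the identity function over the powers of `g` gives an invariant function with increment
`2np`. -/
theorem isElliptic_of_pow_eq_one [NeZero n] {p : ℕ} (hp : 0 < p) (h : g ^ p = 1) :
    IsElliptic g := by
  obtain ⟨v, hv2, hv⟩ := exists_ev_eq (n := n)
    (x := fun z => ∑ t ∈ Finset.range p, ((((g ^ t : affineA (2 * n)) : Equiv.Perm ℤ) z : ℤ) : ℚ))
    (l := p * ((2 * n : ℕ) : ℤ)) (by
      intro z
      have : ∀ t : ℕ, ((((g ^ t : affineA (2 * n)) : Equiv.Perm ℤ) (z + ((2 * n : ℕ) : ℤ)) : ℤ) : ℚ)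
          = ((((g ^ t : affineA (2 * n)) : Equiv.Perm ℤ) z : ℤ) : ℚ) + ((2 * n : ℕ) : ℤ) := by
        intro t
        have := affineA_add_mul (g ^ t) z 1
        rw [one_mul] at this
        rw [this, Int.cast_add]
      simp only [this, Finset.sum_add_distrib, Finset.sum_const, Finset.card_range, nsmul_eq_mul])
  refine ⟨v, fun z => ?_, ?_⟩
  · rw [hv, hv]
    have h1 := Finset.sum_range_succ
      (fun t => ((((g ^ t : affineA (2 * n)) : Equiv.Perm ℤ) z : ℤ) : ℚ)) p
    have h2 := Finset.sum_range_succ'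
      (fun t => ((((g ^ t : affineA (2 * n)) : Equiv.Perm ℤ) z : ℤ) : ℚ)) p
    simp only [pow_succ, Subgroup.coe_mul, Equiv.Perm.mul_apply, pow_zero] at h2
    rw [h] at h1
    exact add_right_cancel (h2.symm.trans h1)
  · rw [hv2]
    have := two_mul_cast_ne_zero (n := n)
    have hp' : (p : ℚ) ≠ 0 := by exact_mod_cast hp.ne'
    exact mul_ne_zero hp' (by exact_mod_cast this)

theorem isElliptic_of_forall_pow [NeZero n]
    (h : ∀ z : ℤ, ∃ q : ℕ, 0 < q ∧ ((g ^ q : affineA (2 * n)) : Equiv.Perm ℤ) z = z) :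
    IsElliptic g := by
  obtain ⟨p, hp, hpz⟩ := exists_pow_intCast_eq g
  refine isElliptic_of_pow_eq_one hp (Subtype.ext (Equiv.ext fun z => ?_))
  obtain ⟨m, hm⟩ := intCast_eq_iff.1 (hpz z)
  obtain ⟨q, hq, hqz⟩ := h z
  have h1 := pow_apply_of_translate hm q
  have h2 := pow_apply_of_translate (m := 0) (by rw [hqz]; ring) p
  rw [mul_comm q p, h1] at h2
  have h3 : (q : ℤ) ≠ 0 := by exact_mod_cast hq.ne'
  have h4 : m = 0 := by
    have h5 : ((q : ℤ) * m) * ((2 * n : ℕ) : ℤ) = 0 := by linarith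
    rcases mul_eq_zero.1 h5 with h | h
    · exact (mul_eq_zero.1 h).resolve_left h3
    · exact absurd h two_mul_cast_ne_zero
  rw [hm, h4]
  simp

theorem IsElliptic.pow_apply_eq [NeZero n] (hg : IsElliptic g) {p : ℕ} {z : ℤ}
    (h : ((((g ^ p : affineA (2 * n)) : Equiv.Perm ℤ) z : ℤ) : ZMod (2 * n)) = z) :
    ((g ^ p : affineA (2 * n)) : Equiv.Perm ℤ) z = z :=
  (hg.of_le (fixedSpace_le_pow g p)).apply_eq_self h

end Elliptic

/-! ### Reflections of type `C̃`: symmetric transpositions and pairs -/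

section ReflectionsC

variable {n : ℕ}

theorem intCast_ne_of_emod {z w : ℤ} (h : z % 2 ≠ w % 2) : (z : ZMod (2 * n)) ≠ w :=
  fun e => h (emod_two_eq_of_intCast_eq e)

theorem intCast_one_sub_eq {z w : ℤ} :
    (((1 - z : ℤ) : ℤ) : ZMod (2 * n)) = w ↔ (z : ZMod (2 * n)) = ((1 - w : ℤ) : ℤ) := by
  push_cast
  constructor <;> intro h
  · rw [← h]; ring
  · rw [h]; ring

theorem intCast_one_sub_inj {z w : ℤ} :
    (((1 - z : ℤ) : ℤ) : ZMod (2 * n)) = ((1 - w : ℤ) : ℤ) ↔ (z : ZMod (2 * n)) = w := by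
  rw [intCast_one_sub_eq, sub_sub_cancel]

theorem conj_mem_reflectionsC {t : affineC n} (h : t ∈ reflectionsC n) (g : affineC n) :
    g * t * g⁻¹ ∈ reflectionsC n := by
  obtain ⟨k, i, hi, e⟩ := h
  refine ⟨g * k, i, hi, ?_⟩
  rw [Subgroup.coe_mul, Subgroup.coe_mul, e, Subgroup.coe_mul, Subgroup.coe_inv]
  group

/-- Since `-kn` and `kn` are congruent modulo `2n`, the map `z ↦ 1 - z` preserves this
transposition. -/
theorem s_mul_mem_affineC (k : ℤ) : s n (k * n) ∈ affineC n := by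
  have h1 := isTransposition_s (n := n) (i := k * n) (j := k * n) rfl
  have h2 := isTransposition_s (n := n) (i := k * n) (j := -(k * n))
    (intCast_eq_iff.2 ⟨-k, by push_cast; ring⟩)
  refine mem_affineC_of_apply (h1.apply_one_sub ?_)
  convert h2.symm using 1 <;> ring

theorem s_mul_mem_reflectionsC (k : ℤ) : ⟨s n (k * n), s_mul_mem_affineC k⟩ ∈ reflectionsC n := by
  rcases Int.even_or_odd' k with ⟨l, hl | hl⟩
  · refine ⟨1, 0, Nat.zero_le _, ?_⟩
    have h := isTransposition_s (n := n) (i := 2 * n) (j := k * n)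
      (intCast_eq_iff.2 ⟨l - 1, by rw [hl]; push_cast; ring⟩)
    simpa [simpleC] using (isTransposition_s rfl).ext h
  · refine ⟨1, n, le_rfl, ?_⟩
    have h := isTransposition_s (n := n) (i := n) (j := k * n)
      (intCast_eq_iff.2 ⟨l, by rw [hl]; push_cast; ring⟩)
    have h' := (isTransposition_s (n := n) (i := k * n) rfl).ext h
    rcases Nat.eq_zero_or_pos n with rfl | hn
    · simp [simpleC]
    · simpa [simpleC, hn.ne'] using h'

/-- `t` is the product of the periodic transpositions of `i, j` and of `1 - i, 1 - j`. -/
def IsPair (t : affineC n) (i j : ℤ) : Prop :=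
  ∃ r r' : affineA (2 * n), IsTransposition r i j ∧ IsTransposition r' (1 - i) (1 - j) ∧
    (t : affineA (2 * n)) = r * r'

theorem IsPair.symm {t : affineC n} {i j : ℤ} (h : IsPair t i j) : IsPair t j i := by
  obtain ⟨r, r', h1, h2, h3⟩ := h
  exact ⟨r, r', h1.symm, h2.symm, h3⟩

theorem IsPair.conj {t : affineC n} {i j : ℤ} (h : IsPair t i j) (g : affineC n) :
    IsPair (g * t * g⁻¹) (((g : affineA (2 * n)) : Equiv.Perm ℤ) i)
      (((g : affineA (2 * n)) : Equiv.Perm ℤ) j) := by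
  obtain ⟨r, r', h1, h2, h3⟩ := h
  refine ⟨g * r * g⁻¹, g * r' * g⁻¹, h1.conj g, ?_, ?_⟩
  · rw [← affineC_apply_one_sub, ← affineC_apply_one_sub]
    exact h2.conj g
  · rw [Subgroup.coe_mul, Subgroup.coe_mul, h3, Subgroup.coe_inv]
    group

theorem IsPair.apply_left {t : affineC n} {i j : ℤ} (h : IsPair t i j)
    (hj : (j : ZMod (2 * n)) ≠ ((1 - i : ℤ) : ZMod (2 * n))) :
    ((t : affineA (2 * n)) : Equiv.Perm ℤ) i = j := by
  obtain ⟨r, r', h1, h2, h3⟩ := h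
  rw [h3, Subgroup.coe_mul, Equiv.Perm.mul_apply, h2.fixed, h1.left]
  · exact intCast_ne_of_emod (by omega)
  · exact fun h => hj (intCast_one_sub_eq.1 h.symm)

theorem IsPair.apply_of_ne {t : affineC n} {i j : ℤ} (h : IsPair t i j) {z : ℤ}
    (h1 : (z : ZMod (2 * n)) ≠ i) (h2 : (z : ZMod (2 * n)) ≠ j)
    (h3 : (z : ZMod (2 * n)) ≠ ((1 - i : ℤ) : ZMod (2 * n)))
    (h4 : (z : ZMod (2 * n)) ≠ ((1 - j : ℤ) : ZMod (2 * n))) :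
    ((t : affineA (2 * n)) : Equiv.Perm ℤ) z = z := by
  obtain ⟨r, r', hr, hr', e⟩ := h
  rw [e, Subgroup.coe_mul, Equiv.Perm.mul_apply, hr'.fixed z h3 h4, hr.fixed z h1 h2]

theorem exists_isPair {i j : ℤ} (hij : (i : ZMod (2 * n)) ≠ j)
    (hj : (j : ZMod (2 * n)) ≠ ((1 - i : ℤ) : ZMod (2 * n))) : ∃ t : affineC n, IsPair t i j := by
  obtain ⟨r, -, h⟩ := exists_isTransposition hij
  obtain ⟨r', -, h'⟩ := exists_isTransposition (intCast_one_sub_inj.not.2 hij)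
  -- The supports are disjoint: `z` and `1 - z` have opposite parity, hence are never congruent
  -- modulo `2n`, and `hj` excludes the remaining coincidence.
  have hcomm : r * r' = r' * r := by
    have h1 := h'.conj r
    rw [h.fixed (1 - i) (intCast_ne_of_emod (by omega)) hj.symm,
      h.fixed (1 - j) (fun e => hj (intCast_one_sub_eq.1 e)) (intCast_ne_of_emod (by omega))] at h1
    rw [← mul_inv_eq_iff_eq_mul]
    exact h1.ext h'
  have h'' : IsTransposition r (1 - (1 - i)) (1 - (1 - j)) := by simpa using h
  refine ⟨⟨r * r', mem_affineC_of_apply fun z => ?_⟩, r, r', h, h', rfl⟩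
  rw [Subgroup.coe_mul, Equiv.Perm.mul_apply, h'.apply_one_sub h'', h.apply_one_sub h']
  exact congrArg (fun g : affineA (2 * n) => 1 - (g : Equiv.Perm ℤ) z) hcomm.symm

theorem exists_affineC_apply_eq_sub_one (j : ℤ) :
    ∃ g : affineC n, ((g : affineA (2 * n)) : Equiv.Perm ℤ) j = j - 1 := by
  by_cases h : ((j - 1 : ℤ) : ZMod (2 * n)) = ((1 - j : ℤ) : ZMod (2 * n))
  · obtain ⟨k, hk⟩ := intCast_eq_iff.1 h
    have hj : j - 1 = k * n := by push_cast at hk; linarith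
    refine ⟨⟨s n (k * n), s_mul_mem_affineC k⟩, ?_⟩
    have := (isTransposition_s (n := n) (i := k * n) rfl).right
    rw [← hj, sub_add_cancel] at this
    convert this using 4
    exact hj.symm
  · obtain ⟨t, ht⟩ := exists_isPair (n := n) (i := j) (j := j - 1)
      (intCast_ne_of_emod (by omega)) h
    exact ⟨t, ht.apply_left h⟩

/-- An element of `W(C̃_n)` taking `j` to `j - 1` takes `i` to `i + 1` by symmetry. Conjugation thus
reduces the distance, which is odd, by `2` down to the case of `s_{kn}`. -/
theorem exists_symmetric_of_sub_eq (d : ℕ) : ∀ i j k : ℤ, j = 1 - i + k * ((2 * n : ℕ) : ℤ) →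
    j - i = d → ∃ t ∈ reflectionsC n, IsTransposition (t : affineA (2 * n)) i j := by
  induction d using Nat.strong_induction_on with
  | _ d ih =>
    intro i j k hj hd
    have hpar : d % 2 = 1 := by
      have : (d : ℤ) = 1 + 2 * (k * n - i) := by rw [← hd, hj]; push_cast; ring
      omega
    by_cases hd1 : d = 1
    · have hi : i = k * n := by subst hd1; push_cast at hj hd; linarith
      refine ⟨_, s_mul_mem_reflectionsC k, ?_⟩
      rw [show j = i + 1 by subst hd1; push_cast at hd; linarith]
      exact isTransposition_s (by rw [hi])
    obtain ⟨g, hg⟩ := exists_affineC_apply_eq_sub_one (n := n) j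
    have hgi : ((g : affineA (2 * n)) : Equiv.Perm ℤ) i = i + 1 := by
      rw [show i = 1 - j + k * ((2 * n : ℕ) : ℤ) by rw [hj]; ring, affineA_add_mul,
        affineC_apply_one_sub, hg]
      ring
    obtain ⟨t, ht, h⟩ := ih (d - 2) (by omega) (i + 1) (j - 1) k (by rw [hj]; ring) (by omega)
    refine ⟨_, conj_mem_reflectionsC ht g⁻¹, ?_⟩
    have := h.conj (g⁻¹ : affineC n)
    rw [← hg, ← hgi] at this
    simpa using this

theorem exists_symmetric (i k : ℤ) : ∃ t ∈ reflectionsC n,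
    IsTransposition (t : affineA (2 * n)) i (1 - i + k * ((2 * n : ℕ) : ℤ)) := by
  rcases le_total i (1 - i + k * ((2 * n : ℕ) : ℤ)) with h | h
  · exact exists_symmetric_of_sub_eq (1 - i + k * ((2 * n : ℕ) : ℤ) - i).toNat i _ k rfl
      (by omega)
  · obtain ⟨t, ht, h'⟩ := exists_symmetric_of_sub_eq (n := n)
      (i - (1 - i + k * ((2 * n : ℕ) : ℤ))).toNat
      (1 - i + k * ((2 * n : ℕ) : ℤ)) i k (by ring) (by omega)
    exact ⟨t, ht, h'.symm⟩

/-- Every integer is congruent, up to `z ↦ 1 - z`, to an integer between `1` and `n`. -/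
theorem exists_representative [NeZero n] (i : ℤ) : ∃ a : ℤ, 1 ≤ a ∧ a ≤ n ∧
    ((∃ k : ℤ, a = i + k * ((2 * n : ℕ) : ℤ)) ∨
      ∃ k : ℤ, a = 1 - i + k * ((2 * n : ℕ) : ℤ)) := by
  have hN := two_mul_cast_ne_zero (n := n)
  have h1 := Int.emod_nonneg (i - 1) hN
  have h2 := Int.emod_lt_of_pos (i - 1) (show (0 : ℤ) < ((2 * n : ℕ) : ℤ) by omega)
  have h3 := Int.emod_add_ediv_mul (i - 1) ((2 * n : ℕ) : ℤ)
  set m := (i - 1) % ((2 * n : ℕ) : ℤ)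
  set q := (i - 1) / ((2 * n : ℕ) : ℤ)
  by_cases hm : m < n
  · exact ⟨m + 1, by omega, by omega, Or.inl ⟨-q, by linarith⟩⟩
  · refine ⟨((2 * n : ℕ) : ℤ) - m, by omega, by push_cast; omega, Or.inr ⟨q + 1, by linarith⟩⟩

section PairReflections

theorem exists_pair_of_conj {i j : ℤ} (g : affineC n)
    (h : ∃ t ∈ reflectionsC n, IsPair t (((g : affineA (2 * n)) : Equiv.Perm ℤ) i)
      (((g : affineA (2 * n)) : Equiv.Perm ℤ) j)) :
    ∃ t ∈ reflectionsC n, IsPair t i j := by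
  obtain ⟨t, ht, h⟩ := h
  refine ⟨_, conj_mem_reflectionsC ht g⁻¹, ?_⟩
  simpa using h.conj g⁻¹

theorem exists_pair_of_flip {i j : ℤ} (k : ℤ) (hij : (i : ZMod (2 * n)) ≠ j)
    (hj : (j : ZMod (2 * n)) ≠ ((1 - i : ℤ) : ZMod (2 * n)))
    (h : ∃ t ∈ reflectionsC n, IsPair t (1 - i + k * ((2 * n : ℕ) : ℤ)) j) :
    ∃ t ∈ reflectionsC n, IsPair t i j := by
  obtain ⟨t, -, ht⟩ := exists_symmetric (n := n) i k
  refine exists_pair_of_conj t ?_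
  rwa [ht.left, ht.fixed j hij.symm (by rwa [intCast_add_mul])]

/-- A translation of one endpoint is a composite of two flips. -/
theorem exists_pair_of_translate {i j : ℤ} (k : ℤ) (hij : (i : ZMod (2 * n)) ≠ j)
    (hj : (j : ZMod (2 * n)) ≠ ((1 - i : ℤ) : ZMod (2 * n)))
    (h : ∃ t ∈ reflectionsC n, IsPair t (i + k * ((2 * n : ℕ) : ℤ)) j) :
    ∃ t ∈ reflectionsC n, IsPair t i j := by
  refine exists_pair_of_flip 0 hij hj (exists_pair_of_flip k ?_ ?_ ?_)
  · rw [intCast_add_mul]; exact hj.symm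
  · rw [show 1 - (1 - i + 0 * ((2 * n : ℕ) : ℤ)) = i by ring]; exact hij.symm
  · rwa [show 1 - (1 - i + 0 * ((2 * n : ℕ) : ℤ)) + k * ((2 * n : ℕ) : ℤ)
      = i + k * ((2 * n : ℕ) : ℤ) by ring]

theorem intCast_ne_of_lt {z w : ℤ} (h1 : z < w) (h2 : w - z < ((2 * n : ℕ) : ℤ)) :
    (z : ZMod (2 * n)) ≠ w := fun h => by
  have h3 := Int.le_of_dvd (by omega) (intCast_eq_iff_dvd.1 h.symm)
  omega

/-- The pair of `a, a + 1` is `σ_a`; any other is conjugate to it by the pair of `b, a + 1`, which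
fixes `a`. That conjugator only has to lie in the group, so there is no circularity. -/
theorem exists_pair_of_le {a b : ℤ} (ha : 1 ≤ a) (hab : a < b) (hb : b ≤ n) :
    ∃ t ∈ reflectionsC n, IsPair t a b := by
  have hbase : ∃ t ∈ reflectionsC n, IsPair t a (a + 1) := by
    have h1 := isTransposition_s (n := n) (i := a) rfl
    have h2 := isTransposition_s (n := n) (i := 2 * n - a) (j := -a)
      (intCast_eq_iff.2 ⟨-1, by push_cast; ring⟩)
    have h2' : IsTransposition (s n (2 * n - a)) (1 - a) (1 - (a + 1)) := by
      convert h2.symm using 1 <;> ring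
    obtain ⟨t, ht⟩ := exists_isPair (n := n) (i := a) (j := a + 1)
      (intCast_ne_of_emod (by omega)) (intCast_ne_of_lt (by omega) (by omega)).symm
    refine ⟨t, ⟨1, a.toNat, by omega, ?_⟩, ht⟩
    obtain ⟨r, r', hr, hr', e⟩ := ht
    rw [e, hr.ext h1, hr'.ext h2', simpleC, if_neg (by omega), if_neg (by omega),
      Int.toNat_of_nonneg (by omega)]
    simp
  rcases eq_or_lt_of_le (show a + 1 ≤ b by omega) with rfl | hlt
  · exact hbase
  obtain ⟨t, ht⟩ := exists_isPair (n := n) (i := b) (j := a + 1)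
    (intCast_ne_of_lt hlt (by omega)).symm (intCast_ne_of_lt (by omega) (by omega)).symm
  refine exists_pair_of_conj t ?_
  rw [ht.apply_left (intCast_ne_of_lt (by omega) (by omega)).symm, ht.apply_of_ne]
  · exact hbase
  · exact intCast_ne_of_lt hab (by omega)
  · exact intCast_ne_of_lt (by omega) (by omega)
  · exact (intCast_ne_of_lt (by omega) (by omega)).symm
  · exact (intCast_ne_of_lt (by omega) (by omega)).symm

theorem exists_pair [NeZero n] {i j : ℤ} (hij : (i : ZMod (2 * n)) ≠ j)
    (hj : (j : ZMod (2 * n)) ≠ ((1 - i : ℤ) : ZMod (2 * n))) :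
    ∃ t ∈ reflectionsC n, IsPair t i j := by
  have hsym : ∀ {i j : ℤ}, (∃ t ∈ reflectionsC n, IsPair t i j) →
      ∃ t ∈ reflectionsC n, IsPair t j i := fun ⟨t, ht, h⟩ => ⟨t, ht, h.symm⟩
  have hred : ∀ {i j : ℤ}, (i : ZMod (2 * n)) ≠ j →
      (j : ZMod (2 * n)) ≠ ((1 - i : ℤ) : ZMod (2 * n)) →
      (∀ a : ℤ, 1 ≤ a → a ≤ n → (a : ZMod (2 * n)) ≠ j →
        (j : ZMod (2 * n)) ≠ ((1 - a : ℤ) : ZMod (2 * n)) →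
        ∃ t ∈ reflectionsC n, IsPair t a j) → ∃ t ∈ reflectionsC n, IsPair t i j := by
    intro i j hij hj h
    obtain ⟨a, ha1, han, ⟨k, hk⟩ | ⟨k, hk⟩⟩ := exists_representative (n := n) i
    · have hai : (a : ZMod (2 * n)) = i := intCast_eq_iff.2 ⟨k, hk⟩
      refine exists_pair_of_translate k hij hj (hk ▸ h a ha1 han (hai ▸ hij) ?_)
      push_cast at hj ⊢
      rwa [hai]
    · have hai : (a : ZMod (2 * n)) = ((1 - i : ℤ) : ℤ) := intCast_eq_iff.2 ⟨k, hk⟩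
      refine exists_pair_of_flip k hij hj (hk ▸ h a ha1 han (hai ▸ hj.symm) ?_)
      rw [intCast_one_sub_eq.2 (by rw [hai])]
      exact hij.symm
  refine hred hij hj fun a ha1 han haj hja => hsym (hred haj.symm ?_ fun b hb1 hbn hba hab => ?_)
  · exact fun h => hja (intCast_one_sub_eq.1 h.symm)
  · rcases lt_trichotomy a b with h | rfl | h
    · exact hsym (exists_pair_of_le ha1 h hbn)
    · exact absurd rfl hba
    · exact exists_pair_of_le hb1 h han

end PairReflections

section Generation

theorem exists_hasExprC_apply_eq [NeZero n] (i j : ℤ) : ∃ t : affineC n,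
    (∃ k, HasExpr (reflectionsC n) t k) ∧ ((t : affineA (2 * n)) : Equiv.Perm ℤ) j = i ∧
    ∀ z : ℤ, (z : ZMod (2 * n)) ≠ i → (z : ZMod (2 * n)) ≠ j →
      (z : ZMod (2 * n)) ≠ ((1 - i : ℤ) : ℤ) → (z : ZMod (2 * n)) ≠ ((1 - j : ℤ) : ℤ) →
      ((t : affineA (2 * n)) : Equiv.Perm ℤ) z = z := by
  by_cases hij : (i : ZMod (2 * n)) = j
  -- Two symmetric reflections compose to `j ↦ 1 - j ↦ j + 2nk = i`.
  · obtain ⟨k, hk⟩ := intCast_eq_iff.1 hij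
    obtain ⟨t, ht, h⟩ := exists_symmetric (n := n) j 0
    obtain ⟨t', ht', h'⟩ := exists_symmetric (n := n) (1 - j) k
    refine ⟨t' * t, ⟨_, (hasExpr_of_mem ht').mul (hasExpr_of_mem ht)⟩, ?_, ?_⟩
    · rw [zero_mul, add_zero] at h
      rw [Subgroup.coe_mul, Subgroup.coe_mul, Equiv.Perm.mul_apply, h.left, h'.left, hk]
      ring
    · intro z h1 h2 h3 h4
      rw [Subgroup.coe_mul, Subgroup.coe_mul, Equiv.Perm.mul_apply, h.fixed z h2, h'.fixed z h4]
      · rwa [intCast_add_mul, sub_sub_cancel]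
      · rwa [intCast_add_mul]
  by_cases hj : (j : ZMod (2 * n)) = ((1 - i : ℤ) : ℤ)
  · obtain ⟨k, rfl⟩ := intCast_eq_iff.1 hj
    obtain ⟨t, ht, h⟩ := exists_symmetric (n := n) i k
    exact ⟨t, ⟨_, hasExpr_of_mem ht⟩, h.right, fun z h1 h2 _ _ => h.fixed z h1 h2⟩
  · obtain ⟨t, ht, h⟩ := exists_pair hij hj
    refine ⟨t, ⟨_, hasExpr_of_mem ht⟩, h.symm.apply_left ?_, fun z h1 h2 h3 h4 =>
      h.apply_of_ne h1 h2 h3 h4⟩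
    exact fun e => hj (intCast_one_sub_eq.1 e.symm)

/-- The reflections of `W(C̃_n)` generate it. -/
theorem exists_hasExprC [NeZero n] (g : affineC n) : ∃ k, HasExpr (reflectionsC n) g k := by
  classical
  let moved : affineC n → Finset (ZMod (2 * n)) := fun g =>
    Finset.univ.filter fun a => ∃ z : ℤ, (z : ZMod (2 * n)) = a ∧
      ((g : affineA (2 * n)) : Equiv.Perm ℤ) z ≠ z
  have hmoved : ∀ (g : affineC n) (z : ℤ), (z : ZMod (2 * n)) ∈ moved g ↔
      ((g : affineA (2 * n)) : Equiv.Perm ℤ) z ≠ z := by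
    intro g z
    simp only [moved, Finset.mem_filter, Finset.mem_univ, true_and]
    refine ⟨fun ⟨y, hy, h⟩ e => h ?_, fun h => ⟨z, rfl, h⟩⟩
    obtain ⟨k, rfl⟩ := intCast_eq_iff.1 hy
    rw [affineA_add_mul, e]
  induction hm : (moved g).card using Nat.strong_induction_on generalizing g with
  | _ m ih =>
    by_cases h1 : (g : affineA (2 * n)) = 1
    · rw [show g = 1 from Subtype.ext h1]
      exact ⟨0, hasExpr_one⟩
    obtain ⟨i, hi⟩ := exists_apply_ne h1
    -- Induction on the number of moved residues: `t⁻¹ * g` fixes `i`, and the support of `t` lies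
    -- within residues already moved by `g`.
    obtain ⟨t, ⟨k, hk⟩, hti, htz⟩ := exists_hasExprC_apply_eq (n := n)
      (((g : affineA (2 * n)) : Equiv.Perm ℤ) i) i
    have happ : ∀ z, (((t⁻¹ * g : affineC n) : affineA (2 * n)) : Equiv.Perm ℤ) z = z ↔
        ((g : affineA (2 * n)) : Equiv.Perm ℤ) z = ((t : affineA (2 * n)) : Equiv.Perm ℤ) z := by
      intro z
      rw [Subgroup.coe_mul, Subgroup.coe_mul, Equiv.Perm.mul_apply, Subgroup.coe_inv,
        Subgroup.coe_inv, Equiv.Perm.inv_eq_iff_eq]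
    have hlt : (moved (t⁻¹ * g)).card < (moved g).card := by
      apply Finset.card_lt_card
      rw [Finset.ssubset_iff_of_subset]
      · refine ⟨i, (hmoved g i).2 hi, ?_⟩
        rw [hmoved, not_not, happ, hti]
      · intro a ha
        obtain ⟨z, rfl⟩ := ZMod.intCast_surjective a
        rw [hmoved] at ha ⊢
        intro hz
        have hne : ∀ y : ℤ, ((g : affineA (2 * n)) : Equiv.Perm ℤ) y ≠ y →
            (z : ZMod (2 * n)) ≠ y := fun y hy e => by
          rw [← hmoved, ← e, hmoved] at hy
          exact hy hz
        have hi' : ((g : affineA (2 * n)) : Equiv.Perm ℤ) (1 - i) ≠ 1 - i := by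
          rw [affineC_apply_one_sub]; omega
        refine ha ?_
        rw [happ, hz]
        refine (htz z (hne _ ?_) (hne _ hi) (hne _ ?_) (hne _ hi')).symm
        · exact fun e => hi (((g : affineA (2 * n)) : Equiv.Perm ℤ).injective e)
        · rw [← affineC_apply_one_sub]
          exact fun e => hi' (((g : affineA (2 * n)) : Equiv.Perm ℤ).injective e)
    obtain ⟨l, hl⟩ := ih _ (hm ▸ hlt) (t⁻¹ * g) rfl
    exact ⟨_, by simpa using hk.mul hl⟩

end Generation
end ReflectionsC

/-! ### Non-elliptic divisors of the Coxeter element -/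

section Hyperbolic

variable {n : ℕ}

/-- The reflections in a shortest factorization of the Coxeter element have linearly independent
roots: each mirror can be avoided while staying on all the others. -/
theorem exists_mem_fixedSpaceList_notMem [NeZero n] {P Q : List (affineA (2 * n))}
    {r : affineA (2 * n)} (hL : ∀ t ∈ P ++ r :: Q, t ∈ reflectionsA n)
    (hc : (P ++ r :: Q).prod = coxA n) (hlen : (P ++ r :: Q).length ≤ 2 * n) :
    ∃ v ∈ fixedSpaceList (P ++ Q), v ∉ fixedSpace r := by
  by_contra hcon
  push Not at hcon
  have h1 := le_finrank_fixedSpaceList (L := P ++ Q) fun t ht => hL t (by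
    rw [List.mem_append, List.mem_cons] at *; tauto)
  have h2 : Module.finrank ℚ (fixedSpaceList (P ++ Q)) ≤ 1 :=
    finrank_le_one_of_constant fun v hv z =>
      constant_of_prod_eq_coxA (x := fun z => ev n z v) NeZero.one_le hL hc (fun t ht => by
        rw [List.mem_append, List.mem_cons] at ht
        rcases ht with ht | rfl | ht
        · exact hv t (List.mem_append_left _ ht)
        · exact hcon v hv
        · exact hv t (List.mem_append_right _ ht)) z
  simp only [List.length_append, List.length_cons] at h1 hlen
  omega

/-- A non-elliptic factor of the Coxeter element becomes elliptic after removing one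
reflection. -/
theorem exists_eq_reflection_mul_elliptic [NeZero n] {A L B : List (affineA (2 * n))}
    (hL : ∀ t ∈ A ++ L ++ B, t ∈ reflectionsA n) (hc : (A ++ L ++ B).prod = coxA n)
    (hlen : (A ++ L ++ B).length ≤ 2 * n) (hell : ¬ IsElliptic L.prod) :
    ∃ r e : affineA (2 * n), r ∈ reflectionsA n ∧ IsElliptic e ∧ L.prod = r * e := by
  by_cases hex : ∃ P r Q, L = P ++ r :: Q ∧ ∃ v ∈ fixedSpaceList (P ++ Q), v.2 ≠ 0
  · obtain ⟨P, r, Q, rfl, v, hv, h0⟩ := hex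
    refine ⟨P.prod * r * P.prod⁻¹, (P ++ Q).prod, conj_mem_reflectionsA (hL r (by simp)) _,
      ⟨v, fixedSpaceList_le _ hv, h0⟩, ?_⟩
    simp only [List.prod_append, List.prod_cons]
    group
  · exfalso
    push Not at hex
    -- Otherwise a function with increment `1` fixed by all of `L` is built one reflection at a
    -- time. Each correction `w` violates only the equation of `r`, and `hex` forces its increment
    -- to be `0`.
    have key : ∀ P Q : List (affineA (2 * n)), L = P ++ Q → ∃ v ∈ fixedSpaceList P, v.2 = 1 := by
      intro P
      induction P using List.reverseRecOn with
      | nil => exact fun _ _ => ⟨(0, 1), fun r hr => by simp at hr, rfl⟩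
      | append_singleton P r ih =>
        intro Q hPQ
        obtain ⟨v, hv, hv1⟩ := ih (r :: Q) (by simpa using hPQ)
        have e : A ++ L ++ B = (A ++ P) ++ r :: (Q ++ B) := by simp [hPQ]
        rw [e] at hL hc hlen
        obtain ⟨w, hw, hwr⟩ := exists_mem_fixedSpaceList_notMem hL hc hlen
        have hw0 : w.2 = 0 := hex P r Q (by simpa using hPQ) w fun t ht => hw t (by
          simp only [List.mem_append] at ht ⊢; tauto)
        obtain ⟨i, j, ht⟩ := exists_isTransposition_of_mem (hL r (by simp))
        rw [ht.mem_fixedSpace_iff] at hwr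
        refine ⟨v - ((ev n i - ev n j) v / (ev n i - ev n j) w) • w, fun t htm => ?_, ?_⟩
        · rw [List.mem_append, List.mem_singleton] at htm
          rcases htm with htm | rfl
          · exact sub_mem (hv t htm) (Submodule.smul_mem _ _ (hw t (by simp [htm])))
          · rw [ht.mem_fixedSpace_iff, map_sub, map_smul, smul_eq_mul, div_mul_cancel₀ _ hwr,
              sub_self]
        · rw [Prod.snd_sub, Prod.smul_snd, hw0, hv1]
          simp
    obtain ⟨v, hv, hv1⟩ := key L [] (by simp)
    exact hell ⟨v, fixedSpaceList_le _ hv, by rw [hv1]; exact one_ne_zero⟩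

theorem pow_succ_apply (g : affineA (2 * n)) (s : ℕ) (z : ℤ) :
    ((g ^ (s + 1) : affineA (2 * n)) : Equiv.Perm ℤ) z
      = (g : Equiv.Perm ℤ) (((g ^ s : affineA (2 * n)) : Equiv.Perm ℤ) z) := by
  rw [pow_succ', Subgroup.coe_mul, Equiv.Perm.mul_apply]

theorem pow_add_apply (g : affineA (2 * n)) (s t : ℕ) (z : ℤ) :
    ((g ^ (s + t) : affineA (2 * n)) : Equiv.Perm ℤ) z
      = ((g ^ s : affineA (2 * n)) : Equiv.Perm ℤ)
          (((g ^ t : affineA (2 * n)) : Equiv.Perm ℤ) z) := by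
  rw [pow_add, Subgroup.coe_mul, Equiv.Perm.mul_apply]

/-- Multiplying by a transposition does not change an orbit until it is met. -/
theorem IsTransposition.pow_mul_apply {r g : affineA (2 * n)} {a b z : ℤ}
    (h : IsTransposition r a b) (q : ℕ)
    (hz : ∀ s, 0 < s → s ≤ q →
      ((((g ^ s : affineA (2 * n)) : Equiv.Perm ℤ) z : ℤ) : ZMod (2 * n)) ≠ a ∧
      ((((g ^ s : affineA (2 * n)) : Equiv.Perm ℤ) z : ℤ) : ZMod (2 * n)) ≠ b) :
    (((r * g) ^ q : affineA (2 * n)) : Equiv.Perm ℤ) z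
      = ((g ^ q : affineA (2 * n)) : Equiv.Perm ℤ) z := by
  induction q with
  | zero => rw [pow_zero, pow_zero]
  | succ q ih =>
    rw [pow_succ_apply, ih fun s h0 hs => hz s h0 (by omega), Subgroup.coe_mul,
      Equiv.Perm.mul_apply, ← pow_succ_apply,
      h.fixed _ (hz (q + 1) (by omega) le_rfl).1 (hz (q + 1) (by omega) le_rfl).2]

theorem residuePerm_pow_intCast [NeZero n] (g : affineA (2 * n)) (s : ℕ) (z : ℤ) :
    (residuePerm n g ^ s) (z : ZMod (2 * n))
      = ((((g ^ s : affineA (2 * n)) : Equiv.Perm ℤ) z : ℤ) : ZMod (2 * n)) := by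
  rw [← map_pow, residuePerm_intCast]

theorem sameCycle_iff [NeZero n] {g : affineA (2 * n)} {z w : ℤ} :
    (residuePerm n g).SameCycle (z : ZMod (2 * n)) w ↔
      ∃ s : ℕ, ((((g ^ s : affineA (2 * n)) : Equiv.Perm ℤ) z : ℤ) : ZMod (2 * n)) = w := by
  constructor
  · intro h
    obtain ⟨s, -, hs⟩ := h.exists_pow_eq'
    exact ⟨s, by rw [← residuePerm_pow_intCast, hs]⟩
  · rintro ⟨s, hs⟩
    exact ⟨s, by rw [zpow_natCast, residuePerm_pow_intCast, hs]⟩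

theorem affineC_pow_apply_one_sub (g : affineC n) (s : ℕ) (z : ℤ) :
    (((g : affineA (2 * n)) ^ s : affineA (2 * n)) : Equiv.Perm ℤ) (1 - z)
      = 1 - (((g : affineA (2 * n)) ^ s : affineA (2 * n)) : Equiv.Perm ℤ) z := by
  rw [← Subgroup.coe_pow]
  exact affineC_apply_one_sub (g ^ s) z

/-- If a power of `g` translates `i` by `2nm`, it translates `1 - i` by `-2nm`. Along one cycle of
residues the translation is constant, so `m = 0` and the orbit is finite. -/
theorem not_sameCycle_one_sub [NeZero n] (g : affineC n) {i : ℤ}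
    (hi : ∀ q, 0 < q → (((g : affineA (2 * n)) ^ q : affineA (2 * n)) : Equiv.Perm ℤ) i ≠ i) :
    ¬ (residuePerm n (g : affineA (2 * n))).SameCycle (i : ZMod (2 * n)) ((1 - i : ℤ) : ℤ) := by
  rw [sameCycle_iff]
  rintro ⟨q, hq⟩
  obtain ⟨k, hk⟩ := intCast_eq_iff.1 hq
  obtain ⟨p, hp, hpz⟩ := exists_pow_intCast_eq (g : affineA (2 * n))
  obtain ⟨m, hm⟩ := intCast_eq_iff.1 (hpz i)
  have h1 := pow_add_apply (g : affineA (2 * n)) p q i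
  have h2 := pow_add_apply (g : affineA (2 * n)) q p i
  rw [hk, affineA_add_mul, affineC_pow_apply_one_sub, hm] at h1
  rw [hm, affineA_add_mul, hk, add_comm q p, h1] at h2
  have h3 : m * ((2 * n : ℕ) : ℤ) = 0 := by linarith
  exact hi p hp (by rw [hm, h3, add_zero])

/-- Outside of the cycles of `a` and `b`, the product of the transposition of `a, b` with an
elliptic element has finite orbits. -/
theorem sameCycle_of_infinite [NeZero n] {g r e : affineA (2 * n)} {a b z : ℤ}
    (hr : IsTransposition r a b) (he : IsElliptic e) (hg : g = r * e)
    (hz : ∀ q, 0 < q → ((g ^ q : affineA (2 * n)) : Equiv.Perm ℤ) z ≠ z) :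
    (residuePerm n g).SameCycle (z : ZMod (2 * n)) a ∨
      (residuePerm n g).SameCycle (z : ZMod (2 * n)) b := by
  by_contra hcon
  rw [not_or, sameCycle_iff, sameCycle_iff] at hcon
  push Not at hcon
  obtain ⟨p, hp, hpz⟩ := exists_pow_intCast_eq e
  have h1 := hr.pow_mul_apply (g := g) (z := z) p fun s _ _ => ⟨hcon.1 s, hcon.2 s⟩
  have h2 : r * g = e := by rw [hg, ← mul_assoc, hr.mul_self, one_mul]
  rw [h2, he.pow_apply_eq (hpz z)] at h1
  exact hz p hp h1.symm

/-- The factorization leaves at most two cycles of residues with infinite orbits, those of `a` and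
`b`. They must be the distinct cycles of `i` and `1 - i`, whose translations are opposite and cancel
once `t` merges them. -/
theorem exists_symmetric_mul_elliptic [NeZero n] (g : affineC n)
    (hg : ¬ IsElliptic (g : affineA (2 * n))) {r e : affineA (2 * n)} (hr : r ∈ reflectionsA n)
    (he : IsElliptic e) (hgr : (g : affineA (2 * n)) = r * e) :
    ∃ i : ℤ, ∀ t : affineA (2 * n), IsTransposition t i (1 - i) → IsElliptic (t * (g : affineA (2 * n))) := by
  obtain ⟨a, b, hab⟩ := exists_isTransposition_of_mem hr
  have hex : ∃ i, ∀ q, 0 < q →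
      (((g : affineA (2 * n)) ^ q : affineA (2 * n)) : Equiv.Perm ℤ) i ≠ i := by
    by_contra hcon
    push Not at hcon
    exact hg (isElliptic_of_forall_pow hcon)
  obtain ⟨i, hi⟩ := hex
  refine ⟨i, fun t ht => ?_⟩
  have hi' : ∀ q, 0 < q →
      (((g : affineA (2 * n)) ^ q : affineA (2 * n)) : Equiv.Perm ℤ) (1 - i) ≠ 1 - i := by
    intro q hq h
    rw [affineC_pow_apply_one_sub] at h
    exact hi q hq (by linarith)
  have hnot := not_sameCycle_one_sub g hi
  have hcycle : ∀ z : ℤ, (∀ q, 0 < q →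
      (((g : affineA (2 * n)) ^ q : affineA (2 * n)) : Equiv.Perm ℤ) z ≠ z) →
      (residuePerm n (g : affineA (2 * n))).SameCycle (z : ZMod (2 * n)) i ∨
      (residuePerm n (g : affineA (2 * n))).SameCycle (z : ZMod (2 * n)) ((1 - i : ℤ) : ℤ) := by
    intro z hz
    rcases sameCycle_of_infinite hab he hgr hz with h | h <;>
    rcases sameCycle_of_infinite hab he hgr hi with h1 | h1 <;>
    rcases sameCycle_of_infinite hab he hgr hi' with h2 | h2
    · exact absurd (h1.trans h2.symm) hnot
    · exact Or.inl (h.trans h1.symm)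
    · exact Or.inr (h.trans h2.symm)
    · exact absurd (h1.trans h2.symm) hnot
    · exact absurd (h1.trans h2.symm) hnot
    · exact Or.inr (h.trans h2.symm)
    · exact Or.inl (h.trans h1.symm)
    · exact absurd (h1.trans h2.symm) hnot
  classical
  have hret : ∃ q, 0 < q ∧
      (((((g : affineA (2 * n)) ^ q : affineA (2 * n)) : Equiv.Perm ℤ) i : ℤ) : ZMod (2 * n)) = i :=
    (exists_pow_intCast_eq (g : affineA (2 * n))).imp fun p hp => ⟨hp.1, hp.2 i⟩
  obtain ⟨q, ⟨hq0, hq⟩, hmin⟩ : ∃ q, (0 < q ∧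
      (((((g : affineA (2 * n)) ^ q : affineA (2 * n)) : Equiv.Perm ℤ) i : ℤ) : ZMod (2 * n)) = i)
      ∧ ∀ s, 0 < s → s < q →
        (((((g : affineA (2 * n)) ^ s : affineA (2 * n)) : Equiv.Perm ℤ) i : ℤ) : ZMod (2 * n))
          ≠ i :=
    ⟨Nat.find hret, Nat.find_spec hret, fun s h0 hs h => Nat.find_min hret hs ⟨h0, h⟩⟩
  obtain ⟨μ, hμ⟩ := intCast_eq_iff.1 hq
  have hmin' : ∀ s, (((((g : affineA (2 * n)) ^ s : affineA (2 * n)) : Equiv.Perm ℤ) i : ℤ) :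
      ZMod (2 * n)) ≠ ((1 - i : ℤ) : ℤ) := fun s h => hnot (sameCycle_iff.2 ⟨s, h⟩)
  obtain ⟨q, rfl⟩ : ∃ q', q = q' + 1 := ⟨q - 1, by omega⟩
  -- Up to the first return of `i` to its class, `t * g` follows `g`; then `t` passes to the other
  -- cycle. The next round carries the shift `-μ`, so twice this power fixes `i` and `1 - i`.
  have hA : (((t * (g : affineA (2 * n))) ^ (q + 1) : affineA (2 * n)) : Equiv.Perm ℤ) i
      = 1 - i + μ * ((2 * n : ℕ) : ℤ) := by
    rw [pow_succ_apply, ht.pow_mul_apply q fun s h0 hs => ⟨hmin s h0 (by omega), hmin' s⟩,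
      Subgroup.coe_mul, Equiv.Perm.mul_apply, ← pow_succ_apply, hμ, ht.apply_add_mul]
  have hB : (((t * (g : affineA (2 * n))) ^ (q + 1) : affineA (2 * n)) : Equiv.Perm ℤ) (1 - i)
      = i + (-μ) * ((2 * n : ℕ) : ℤ) := by
    rw [pow_succ_apply, ht.pow_mul_apply q, Subgroup.coe_mul, Equiv.Perm.mul_apply,
      ← pow_succ_apply, affineC_pow_apply_one_sub, hμ,
      show 1 - (i + μ * ((2 * n : ℕ) : ℤ)) = 1 - i + (-μ) * ((2 * n : ℕ) : ℤ) by ring,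
      ht.symm.apply_add_mul]
    intro s h0 hs
    rw [affineC_pow_apply_one_sub]
    exact ⟨fun h => hmin' s (intCast_one_sub_eq.1 h),
      fun h => hmin s h0 (by omega) (intCast_one_sub_inj.1 h)⟩
  have hA2 : (((t * (g : affineA (2 * n))) ^ (q + 1 + (q + 1)) : affineA (2 * n)) : Equiv.Perm ℤ) i = i := by
    rw [pow_add_apply, hA, affineA_add_mul, hB]; ring
  have hB2 : (((t * (g : affineA (2 * n))) ^ (q + 1 + (q + 1)) : affineA (2 * n)) : Equiv.Perm ℤ) (1 - i)
      = 1 - i := by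
    rw [pow_add_apply, hB, affineA_add_mul, hA]; ring
  have hback : ∀ (s : ℕ) (z k j : ℤ),
      (((t * (g : affineA (2 * n))) ^ (q + 1 + (q + 1)) : affineA (2 * n)) : Equiv.Perm ℤ) j = j →
      (((t * (g : affineA (2 * n))) ^ s : affineA (2 * n)) : Equiv.Perm ℤ) z = j + k * ((2 * n : ℕ) : ℤ) →
      (((t * (g : affineA (2 * n))) ^ (q + 1 + (q + 1)) : affineA (2 * n)) : Equiv.Perm ℤ) z = z := by
    intro s z k j hj hs
    apply (((t * (g : affineA (2 * n))) ^ s : affineA (2 * n)) : Equiv.Perm ℤ).injective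
    rw [← pow_add_apply, add_comm, pow_add_apply, hs, affineA_add_mul, hj]
  refine isElliptic_of_forall_pow fun z => ?_
  by_cases h1 : ∃ s, (((((t * (g : affineA (2 * n))) ^ s : affineA (2 * n)) : Equiv.Perm ℤ) z : ℤ) : ZMod (2 * n)) = i
  · obtain ⟨s, hs⟩ := h1
    obtain ⟨k, hk⟩ := intCast_eq_iff.1 hs
    exact ⟨_, by omega, hback s z k i hA2 hk⟩
  by_cases h2 : ∃ s, (((((t * (g : affineA (2 * n))) ^ s : affineA (2 * n)) : Equiv.Perm ℤ) z : ℤ) : ZMod (2 * n))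
      = ((1 - i : ℤ) : ℤ)
  · obtain ⟨s, hs⟩ := h2
    obtain ⟨k, hk⟩ := intCast_eq_iff.1 hs
    exact ⟨_, by omega, hback s z k _ hB2 hk⟩
  push Not at h1 h2
  -- An orbit of `t * g` that avoids `i` and `1 - i` modulo `2n` is an orbit of `g`; if infinite, it
  -- would lie over one of the two cycles after all.
  have hsame : ∀ s, (((g : affineA (2 * n)) ^ s : affineA (2 * n)) : Equiv.Perm ℤ) z
      = (((t * (g : affineA (2 * n))) ^ s : affineA (2 * n)) : Equiv.Perm ℤ) z := by
    intro s
    have := ht.pow_mul_apply (g := t * (g : affineA (2 * n))) (z := z) s fun s _ _ => ⟨h1 s, h2 s⟩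
    rwa [← mul_assoc, ht.mul_self, one_mul] at this
  by_contra hcon
  push Not at hcon
  rcases hcycle z fun q hq => by rw [hsame]; exact hcon q hq with h | h
  · obtain ⟨s, hs⟩ := sameCycle_iff.1 h
    exact h1 s (by rw [← hsame, hs])
  · obtain ⟨s, hs⟩ := sameCycle_iff.1 h
    exact h2 s (by rw [← hsame, hs])

end Hyperbolic

/-! ### From type `Ã` to type `C̃` -/

section Factorization

variable {n : ℕ}

/-- `t` is a reflection of `W(C̃_n)` which is a reflection of `W(Ã_{2n-1})`. -/
def IsSymmetricReflection (t : affineC n) : Prop :=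
  t ∈ reflectionsC n ∧
    ∃ i k : ℤ, IsTransposition (t : affineA (2 * n)) i (1 - i + k * ((2 * n : ℕ) : ℤ))

/-- `t` is a reflection of `W(C̃_n)` which is a product of two commuting reflections
of `W(Ã_{2n-1})`. -/
def IsPairReflection (t : affineC n) : Prop := t ∈ reflectionsC n ∧ ∃ i j : ℤ, IsPair t i j

theorem IsSymmetricReflection.hasExpr {t : affineC n} (h : IsSymmetricReflection t) :
    HasExpr (reflectionsA n) (t : affineA (2 * n)) 1 := by
  obtain ⟨-, i, k, ht⟩ := h
  exact hasExpr_of_mem ht.mem_reflectionsA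

theorem IsPairReflection.hasExpr {t : affineC n} (h : IsPairReflection t) :
    HasExpr (reflectionsA n) (t : affineA (2 * n)) 2 := by
  obtain ⟨-, i, j, r, r', h1, h2, e⟩ := h
  rw [e]
  exact (hasExpr_of_mem h1.mem_reflectionsA).mul (hasExpr_of_mem h2.mem_reflectionsA)

theorem simpleC_cases (n i : ℕ) : simpleC n i = s n (2 * n) ∨ simpleC n i = s n n ∨
    simpleC n i = s n i * s n (2 * n - i) := by
  unfold simpleC
  split_ifs <;> simp

theorem exists_hasExprA_of_mem {t : affineC n} (h : t ∈ reflectionsC n) :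
    ∃ k, HasExpr (reflectionsA n) (t : affineA (2 * n)) k := by
  obtain ⟨g, i, -, e⟩ := h
  rw [e]
  rcases simpleC_cases n i with h | h | h
  · exact ⟨1, hasExpr_of_mem ⟨g, _, by rw [h]⟩⟩
  · exact ⟨1, hasExpr_of_mem ⟨g, _, by rw [h]⟩⟩
  · rw [h, show (g : affineA (2 * n)) * (s n i * s n (2 * n - i)) * (g : affineA (2 * n))⁻¹
      = (g * s n i * (g : affineA (2 * n))⁻¹) * (g * s n (2 * n - i) * (g : affineA (2 * n))⁻¹) by
        group]
    exact ⟨_, (hasExpr_of_mem (S := reflectionsA n) ⟨g, i, rfl⟩).mul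
      (hasExpr_of_mem (S := reflectionsA n) ⟨g, _, rfl⟩)⟩

theorem exists_hasExprA [NeZero n] (g : affineC n) :
    ∃ k, HasExpr (reflectionsA n) (g : affineA (2 * n)) k := by
  obtain ⟨-, L, -, hL, rfl⟩ := exists_hasExprC g
  induction L with
  | nil => exact ⟨0, hasExpr_one⟩
  | cons t L ih =>
    obtain ⟨k, hk⟩ := exists_hasExprA_of_mem (hL t (by simp))
    obtain ⟨l, hl⟩ := ih fun x hx => hL x (by simp [hx])
    exact ⟨k + l, by rw [List.prod_cons, Subgroup.coe_mul]; exact hk.mul hl⟩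

/-- The reflection length of an element of `W(C̃_n)` in `W(Ã_{2n-1})`. -/
noncomputable abbrev lengthA (g : affineC n) : ℕ :=
  genLength (reflectionsA n) (g : affineA (2 * n))

/-- The reflection length in `W(C̃_n)`. -/
noncomputable abbrev lengthC (g : affineC n) : ℕ := genLength (reflectionsC n) g

theorem hasExpr_lengthA [NeZero n] (g : affineC n) :
    HasExpr (reflectionsA n) (g : affineA (2 * n)) (lengthA g) :=
  (exists_hasExprA g).choose_spec.hasExpr_genLength

theorem hasExpr_lengthC [NeZero n] (g : affineC n) : HasExpr (reflectionsC n) g (lengthC g) :=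
  (exists_hasExprC g).choose_spec.hasExpr_genLength

theorem lengthA_mul_le [NeZero n] (g h : affineC n) :
    lengthA (g * h) ≤ lengthA g + lengthA h :=
  (hasExpr_lengthA g).genLength_mul_le (hasExpr_lengthA h)

theorem lengthC_mul_le [NeZero n] (g h : affineC n) :
    lengthC (g * h) ≤ lengthC g + lengthC h :=
  (hasExpr_lengthC g).genLength_mul_le (hasExpr_lengthC h)

/-- `g` is a product of `a` symmetric reflections and `b` pair reflections. -/
inductive SymFactorization : affineC n → ℕ → ℕ → Prop
  | one : SymFactorization 1 0 0
  | symmetric {t g : affineC n} {a b : ℕ} : IsSymmetricReflection t → SymFactorization g a b →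
      SymFactorization (t * g) (a + 1) b
  | pair {t g : affineC n} {a b : ℕ} : IsPairReflection t → SymFactorization g a b →
      SymFactorization (t * g) a (b + 1)

theorem SymFactorization.mul {g h : affineC n} {a b a' b' : ℕ} (hg : SymFactorization g a b)
    (hh : SymFactorization h a' b') : SymFactorization (g * h) (a + a') (b + b') := by
  induction hg with
  | one => simpa using hh
  | symmetric ht _ ih =>
    rw [mul_assoc, add_right_comm]
    exact .symmetric ht ih
  | pair ht _ ih =>
    rw [mul_assoc, add_right_comm]
    exact .pair ht ih

theorem SymFactorization.hasExpr {g : affineC n} {a b : ℕ} (h : SymFactorization g a b) :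
    HasExpr (reflectionsC n) g (a + b) := by
  induction h with
  | one => exact hasExpr_one
  | symmetric ht _ ih =>
    rw [show ∀ a b : ℕ, a + 1 + b = 1 + (a + b) by intros; ring]
    exact (hasExpr_of_mem ht.1).mul ih
  | pair ht _ ih =>
    rw [show ∀ a b : ℕ, a + (b + 1) = 1 + (a + b) by intros; ring]
    exact (hasExpr_of_mem ht.1).mul ih

/-- The quasi-periodic functions invariant under `z ↦ 1 - z`. -/
def evenSpace (n : ℕ) : Submodule ℚ (QuasiPeriodic n) where
  carrier := {v | ∀ z : ℤ, ev n (1 - z) v = ev n z v}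
  add_mem' := fun h h' z => by rw [map_add, map_add, h, h']
  zero_mem' := fun z => by simp
  smul_mem' := fun a v h z => by rw [map_smul, map_smul, h]

/-- Reversing `ℤ` changes the sign of the increment. -/
theorem snd_eq_zero_of_mem_evenSpace [NeZero n] {v : QuasiPeriodic n} (h : v ∈ evenSpace n) :
    v.2 = 0 := by
  have h1 := h ((1 : ℤ) * ((2 * n : ℕ) : ℤ))
  have h2 := h 0
  have h3 := ev_add_mul 0 1 v
  have h4 := ev_add_mul 1 (-1) v
  rw [zero_add, ← h1, show 1 - 1 * ((2 * n : ℕ) : ℤ) = 1 + (-1) * ((2 * n : ℕ) : ℤ) by ring, h4] at h3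
  rw [sub_zero] at h2
  push_cast at h3
  linarith

theorem le_finrank_iInf_ker {E : Type*} [AddCommGroup E] [Module ℚ E] [FiniteDimensional ℚ E]
    (L : List (E →ₗ[ℚ] ℚ)) : ∃ W : Submodule ℚ E, (∀ v ∈ W, ∀ f ∈ L, f v = 0) ∧
      Module.finrank ℚ E ≤ Module.finrank ℚ W + L.length := by
  induction L with
  | nil => exact ⟨⊤, by simp, by simp⟩
  | cons f L ih =>
    obtain ⟨W, hW, hd⟩ := ih
    refine ⟨W ⊓ LinearMap.ker f, fun v hv => List.forall_mem_cons.2 ⟨hv.2, hW v hv.1⟩, ?_⟩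
    have := finrank_le_finrank_inf_ker W f
    rw [List.length_cons]
    omega

/-- Only `n + 1` equations are needed in dimension `2n + 1`: zero increment, and symmetry at `1, …,
n`. -/
theorem le_finrank_evenSpace [NeZero n] : n ≤ Module.finrank ℚ (evenSpace n) := by
  obtain ⟨W, hW, hd⟩ := le_finrank_iInf_ker (LinearMap.snd ℚ _ _ ::
    (List.range n).map fun m : ℕ => ev n (1 - (m + 1 : ℤ)) - ev n (m + 1 : ℤ))
  have hle : W ≤ evenSpace n := by
    intro v hv
    have h := hW v hv
    rw [List.forall_mem_cons] at h
    have h2 : v.2 = 0 := h.1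
    have key : ∀ a : ℤ, 1 ≤ a → a ≤ n → ev n (1 - a) v = ev n a v := by
      intro a h1 han
      have := h.2 _ (List.mem_map.2 ⟨(a - 1).toNat, by rw [List.mem_range]; omega, rfl⟩)
      rw [Int.toNat_of_nonneg (by omega), sub_add_cancel] at this
      exact sub_eq_zero.1 this
    intro z
    obtain ⟨a, ha1, han, ⟨k, hk⟩ | ⟨k, hk⟩⟩ := exists_representative (n := n) z
    · have h3 := key a ha1 han
      rw [hk, show 1 - (z + k * ((2 * n : ℕ) : ℤ)) = 1 - z + (-k) * ((2 * n : ℕ) : ℤ) by ring,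
        ev_add_mul, ev_add_mul, h2] at h3
      simpa using h3
    · have h3 := key a ha1 han
      rw [hk, show 1 - (1 - z + k * ((2 * n : ℕ) : ℤ)) = z + (-k) * ((2 * n : ℕ) : ℤ) by ring,
        ev_add_mul, ev_add_mul, h2] at h3
      simpa using h3.symm
  have := Submodule.finrank_mono hle
  rw [finrank_quasiPeriodic, List.length_cons, List.length_map, List.length_range] at hd
  omega

theorem IsTransposition.evenSpace_le [NeZero n] {t : affineA (2 * n)} {i k : ℤ}
    (h : IsTransposition t i (1 - i + k * ((2 * n : ℕ) : ℤ))) : evenSpace n ≤ fixedSpace t := by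
  intro v hv
  rw [h.mem_fixedSpace_iff, LinearMap.sub_apply, ev_add_mul, snd_eq_zero_of_mem_evenSpace hv,
    hv i]
  simp

/-- On even functions a symmetric reflection acts trivially, and the two transpositions of a pair
impose the same equation; hence only `b` is charged. -/
theorem SymFactorization.exists_list [NeZero n] {g : affineC n} {a b : ℕ}
    (h : SymFactorization g a b) : ∃ L : List (affineA (2 * n)), (∀ r ∈ L, r ∈ reflectionsA n) ∧
      L.prod = g ∧ n ≤ Module.finrank ℚ ↥(evenSpace n ⊓ fixedSpaceList L) + b := by
  induction h with
  | one =>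
    refine ⟨[], by simp, rfl, ?_⟩
    have : fixedSpaceList ([] : List (affineA (2 * n))) = ⊤ :=
      eq_top_iff.2 fun v _ r hr => by simp at hr
    rw [this, inf_top_eq]
    exact le_finrank_evenSpace
  | @symmetric t g a b ht _ ih =>
    obtain ⟨L, hL, hg, hd⟩ := ih
    obtain ⟨-, i, k, ht⟩ := ht
    refine ⟨t :: L, List.forall_mem_cons.2 ⟨ht.mem_reflectionsA, hL⟩,
      by rw [List.prod_cons, hg, Subgroup.coe_mul], hd.trans ?_⟩
    gcongr
    exact Submodule.finrank_mono fun v hv =>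
      ⟨hv.1, List.forall_mem_cons.2 ⟨ht.evenSpace_le hv.1, hv.2⟩⟩
  | @pair t g a b ht _ ih =>
    obtain ⟨L, hL, hg, hd⟩ := ih
    obtain ⟨-, i, j, r, r', h1, h2, e⟩ := ht
    refine ⟨r :: r' :: L, List.forall_mem_cons.2 ⟨h1.mem_reflectionsA,
      List.forall_mem_cons.2 ⟨h2.mem_reflectionsA, hL⟩⟩,
      by rw [List.prod_cons, List.prod_cons, hg, Subgroup.coe_mul, e, mul_assoc], ?_⟩
    have h3 := finrank_le_finrank_inf_fixedSpace (evenSpace n ⊓ fixedSpaceList L)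
      h1.mem_reflectionsA
    have h4 : (evenSpace n ⊓ fixedSpaceList L) ⊓ fixedSpace r
        ≤ evenSpace n ⊓ fixedSpaceList (r :: r' :: L) := by
      intro v hv
      refine ⟨hv.1.1, List.forall_mem_cons.2 ⟨hv.2, List.forall_mem_cons.2 ⟨?_, hv.1.2⟩⟩⟩
      have h5 := h1.mem_fixedSpace_iff.1 hv.2
      rw [h2.mem_fixedSpace_iff]
      rw [LinearMap.sub_apply] at h5 ⊢
      rwa [hv.1.1 i, hv.1.1 j]
    have := Submodule.finrank_mono h4
    omega

theorem SymFactorization.add_le [NeZero n] {a b : ℕ} (h : SymFactorization (c n) a b)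
    (hab : a + 2 * b ≤ 2 * n) : a + b ≤ n + 1 := by
  obtain ⟨L, hL, hc, hd⟩ := h.exists_list
  have := finrank_le_one_of_constant (W := evenSpace n ⊓ fixedSpaceList L) fun v hv z =>
    constant_of_prod_eq_coxA (x := fun z => ev n z v) NeZero.one_le hL hc (fun r hr => hv.2 r hr) z
  omega

/-- The transposition `r` of a moved `i` and `g i` divides `g`. Unless it is symmetric, `r * g`
still sends `1 - i` to `1 - g i`, so the mirror image of `r` divides in turn. -/
theorem exists_elliptic_step [NeZero n] {g : affineC n} (hg : IsElliptic (g : affineA (2 * n)))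
    (h1 : (g : affineA (2 * n)) ≠ 1) : ∃ t h : affineC n, g = t * h ∧
      ((IsSymmetricReflection t ∧ lengthA h + 1 ≤ lengthA g) ∨
        (IsPairReflection t ∧ lengthA h + 2 ≤ lengthA g)) := by
  obtain ⟨i, hi⟩ := exists_apply_ne h1
  have hne : (i : ZMod (2 * n)) ≠ (((g : affineA (2 * n)) : Equiv.Perm ℤ) i : ℤ) :=
    fun h => hi (hg.apply_eq_self h.symm)
  have hlen := hg.genLength_add
  by_cases hsym : ((((g : affineA (2 * n)) : Equiv.Perm ℤ) i : ℤ) : ZMod (2 * n))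
      = ((1 - i : ℤ) : ℤ)
  · obtain ⟨k, hk⟩ := intCast_eq_iff.1 hsym
    obtain ⟨t, htC, ht⟩ := exists_symmetric (n := n) i k
    refine ⟨t, t⁻¹ * g, by group, Or.inl ⟨⟨htC, i, k, ht⟩, ?_⟩⟩
    have hle : fixedSpace (g : affineA (2 * n)) ≤ fixedSpace (t : affineA (2 * n)) :=
      IsTransposition.fixedSpace_le (i := i) (by rwa [hk])
    obtain ⟨hell, hd⟩ := hg.mul_reflection ht.mem_reflectionsA hle
    have := hell.genLength_add
    change genLength _ ((t : affineA (2 * n))⁻¹ * g) + 1 ≤ genLength _ (g : affineA (2 * n))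
    rw [ht.inv_eq]
    omega
  · obtain ⟨t, htC, ht⟩ := exists_pair hne hsym
    refine ⟨t, t⁻¹ * g, by group, Or.inr ⟨⟨htC, i, _, ht⟩, ?_⟩⟩
    obtain ⟨r, r', hr, hr', e⟩ := ht
    obtain ⟨hell, hd⟩ := hg.mul_reflection hr.mem_reflectionsA hr.fixedSpace_le
    have hr'' : IsTransposition r' (1 - i)
        (((r * g : affineA (2 * n)) : Equiv.Perm ℤ) (1 - i)) := by
      rw [Subgroup.coe_mul, Equiv.Perm.mul_apply, affineC_apply_one_sub, hr.fixed]
      · exact hr'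
      · exact fun h => hsym (intCast_one_sub_eq.1 h)
      · exact intCast_ne_of_emod (by omega)
    obtain ⟨hell', hd'⟩ := hell.mul_reflection hr'.mem_reflectionsA hr''.fixedSpace_le
    have := hell'.genLength_add
    change genLength _ ((t : affineA (2 * n))⁻¹ * g) + 2 ≤ genLength _ (g : affineA (2 * n))
    rw [e, mul_inv_rev, hr.inv_eq, hr'.inv_eq, mul_assoc]
    omega

/-- The outer factors `x` and `y` serve to complete a shortest expression of `g` to one of `c`,
where the roots are independent. -/
theorem exists_hyperbolic_step [NeZero n] {x g y : affineC n} (hc : x * g * y = c n)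
    (hlen : lengthA x + lengthA g + lengthA y ≤ 2 * n)
    (hg : ¬ IsElliptic (g : affineA (2 * n))) : ∃ t h : affineC n, g = t * h ∧
      IsSymmetricReflection t ∧ lengthA h + 1 ≤ lengthA g := by
  obtain ⟨X, hXl, hX, hx⟩ := hasExpr_lengthA x
  obtain ⟨L, hLl, hL, hLg⟩ := hasExpr_lengthA g
  obtain ⟨Y, hYl, hY, hy⟩ := hasExpr_lengthA y
  obtain ⟨r, e, hr, he, hre⟩ := exists_eq_reflection_mul_elliptic (A := X) (L := L) (B := Y)
    (fun t ht => by
      rw [List.mem_append, List.mem_append] at ht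
      rcases ht with (h | h) | h
      exacts [hX t h, hL t h, hY t h])
    (by rw [List.prod_append, List.prod_append, hx, hLg, hy]; exact congrArg Subtype.val hc)
    (by rw [List.length_append, List.length_append]; omega) (by rwa [hLg])
  obtain ⟨i, hi⟩ := exists_symmetric_mul_elliptic g hg hr he (hLg.symm.trans hre)
  obtain ⟨t, htC, ht⟩ := exists_symmetric (n := n) i 0
  refine ⟨t, t⁻¹ * g, by group, ⟨htC, i, 0, ht⟩, ?_⟩
  have hell := hi t (by simpa using ht)
  have := hell.genLength_add_one_le ht.mem_reflectionsA hg
  change genLength _ ((t : affineA (2 * n))⁻¹ * g) + 1 ≤ genLength _ (g : affineA (2 * n))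
  rwa [ht.inv_eq]

/-- An element of `W(C̃_n)` dividing the Coxeter element in `W(Ã_{2n-1})` is a product of
reflections of `W(C̃_n)` whose lengths in `W(Ã_{2n-1})` add up. -/
theorem exists_symFactorization [NeZero n] {x g y : affineC n} (hc : x * g * y = c n)
    (hlen : lengthA x + lengthA g + lengthA y ≤ 2 * n) :
    ∃ a b, SymFactorization g a b ∧ a + 2 * b ≤ lengthA g := by
  induction hm : lengthA g using Nat.strong_induction_on generalizing x g with
  | _ m ih =>
    by_cases h1 : (g : affineA (2 * n)) = 1
    · rw [show g = 1 from Subtype.ext h1]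
      exact ⟨0, 0, .one, Nat.zero_le _⟩
    obtain ⟨t, h, rfl, hstep⟩ : ∃ t h : affineC n, g = t * h ∧
        ((IsSymmetricReflection t ∧ lengthA h + 1 ≤ lengthA g) ∨
          (IsPairReflection t ∧ lengthA h + 2 ≤ lengthA g)) := by
      by_cases hell : IsElliptic (g : affineA (2 * n))
      · exact exists_elliptic_step hell h1
      · obtain ⟨t, h, e, ht⟩ := exists_hyperbolic_step hc hlen hell
        exact ⟨t, h, e, Or.inl ht⟩
    have hc' : x * t * h * y = c n := by rw [← hc]; group
    have hxt := lengthA_mul_le x t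
    rcases hstep with ⟨ht, hl⟩ | ⟨ht, hl⟩
    · have ht1 : lengthA t ≤ 1 := ht.hasExpr.genLength_le
      obtain ⟨a, b, hab, hle⟩ := ih _ (by omega) hc' (by omega) rfl
      exact ⟨a + 1, b, .symmetric ht hab, by omega⟩
    · have ht1 : lengthA t ≤ 2 := ht.hasExpr.genLength_le
      obtain ⟨a, b, hab, hle⟩ := ih _ (by omega) hc' (by omega) rfl
      exact ⟨a, b + 1, .pair ht hab, by omega⟩

theorem lengthA_c [NeZero n] : lengthA (c n) = 2 * n := genLength_coxA

theorem lengthC_c_le [NeZero n] : lengthC (c n) ≤ n + 1 := by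
  have h1 : lengthA (1 : affineC n) = 0 :=
    Nat.le_zero.1 (hasExpr_one (S := reflectionsA n)).genLength_le
  obtain ⟨a, b, hab, hle⟩ := exists_symFactorization (x := 1) (g := c n) (y := 1) (by simp)
    (by rw [h1, lengthA_c]; omega)
  rw [lengthA_c] at hle
  exact hab.hasExpr.genLength_le.trans (hab.add_le hle)

/-- A factorization of the Coxeter element with additive lengths in `W(Ã_{2n-1})` has length at
most `n + 1` in `W(C̃_n)`. -/
theorem lengthC_add_le [NeZero n] {u v w : affineC n} (hc : u * v * w = c n)
    (hlen : lengthA u + lengthA v + lengthA w ≤ 2 * n) :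
    lengthC u + lengthC v + lengthC w ≤ n + 1 := by
  have h1 : lengthA (1 : affineC n) = 0 :=
    Nat.le_zero.1 (hasExpr_one (S := reflectionsA n)).genLength_le
  have hvw := lengthA_mul_le v w
  have huv := lengthA_mul_le u v
  obtain ⟨a, b, hab, hle⟩ := exists_symFactorization (x := 1) (g := u) (y := v * w)
    (by rw [← hc]; group) (by omega)
  obtain ⟨a', b', hab', hle'⟩ := exists_symFactorization (x := u) (g := v) (y := w) hc hlen
  obtain ⟨a'', b'', hab'', hle''⟩ := exists_symFactorization (x := u * v) (g := w) (y := 1)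
    (by rw [← hc]; group) (by omega)
  have hall := (hab.mul hab').mul hab''
  rw [hc] at hall
  have := hall.add_le (by omega)
  have h2 : lengthC u ≤ _ := hab.hasExpr.genLength_le
  have h3 : lengthC v ≤ _ := hab'.hasExpr.genLength_le
  have h4 : lengthC w ≤ _ := hab''.hasExpr.genLength_le
  omega

end Factorization

/-! ### From type `C̃` to type `Ã`: two sign characters -/

section Crossing

variable {n : ℕ}

/-- The positive integers which `g` maps to non-positive integers. -/
def crossing (g : affineC n) : Set ℤ :=
  {z | 1 ≤ z ∧ ((g : affineA (2 * n)) : Equiv.Perm ℤ) z ≤ 0}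

theorem crossing_finite [NeZero n] (g : affineC n) : (crossing g).Finite := by
  have hN : (0 : ℤ) < ((2 * n : ℕ) : ℤ) := by
    have := two_mul_cast_ne_zero (n := n)
    omega
  obtain ⟨K, hK⟩ := ((Set.finite_Ico (0 : ℤ) ((2 * n : ℕ) : ℤ)).image
    fun z => -((g : affineA (2 * n)) : Equiv.Perm ℤ) z).bddAbove
  refine (Set.finite_Icc 1 (K + ((2 * n : ℕ) : ℤ))).subset fun z hz => ⟨hz.1, ?_⟩
  have h1 := Int.emod_nonneg z hN.ne'
  have h2 := Int.emod_lt_of_pos z hN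
  have h3 := Int.emod_add_ediv_mul z ((2 * n : ℕ) : ℤ)
  have h4 := hK ⟨_, ⟨h1, h2⟩, rfl⟩
  have h5 := affineA_add_mul (g : affineA (2 * n)) (z % ((2 * n : ℕ) : ℤ))
    (z / ((2 * n : ℕ) : ℤ))
  rw [h3] at h5
  have h6 := hz.2
  simp only at h4
  linarith

/-- The crossings that cancel in the product are those which `g` makes and `h` undoes (`Z`). Their
images under `z ↦ 1 - z` (`W`) account for the cancelled crossings of `h`, so the loss is `2 *
Z.ncard`. -/
theorem ncard_crossing_mul [NeZero n] (g h : affineC n) : ∃ m,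
    (crossing g).ncard + (crossing h).ncard = (crossing (h * g)).ncard + 2 * m := by
  let a : ℤ → ℤ := fun z => ((g : affineA (2 * n)) : Equiv.Perm ℤ) z
  let b : ℤ → ℤ := fun z => (((h * g : affineC n) : affineA (2 * n)) : Equiv.Perm ℤ) z
  let Z : Set ℤ := {z | 1 ≤ z ∧ a z ≤ 0 ∧ 1 ≤ b z}
  let W : Set ℤ := {z | z ≤ 0 ∧ 1 ≤ a z ∧ b z ≤ 0}
  let X : Set ℤ := {z | 1 ≤ z ∧ a z ≤ 0 ∧ b z ≤ 0}
  let Y : Set ℤ := {z | 1 ≤ z ∧ 1 ≤ a z ∧ b z ≤ 0}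
  have hX : X.Finite := (crossing_finite g).subset fun z hz => ⟨hz.1, hz.2.1⟩
  have hZ : Z.Finite := (crossing_finite g).subset fun z hz => ⟨hz.1, hz.2.1⟩
  have hY : Y.Finite := (crossing_finite (h * g)).subset fun z hz => ⟨hz.1, hz.2.2⟩
  have hWZ : W = (fun z => 1 - z) '' Z := by
    ext z
    constructor
    · intro hz
      refine ⟨1 - z, ⟨?_, ?_, ?_⟩, by ring⟩
      · have := hz.1; omega
      · have := hz.2.1
        simp only [a] at this ⊢
        rw [affineC_apply_one_sub]; omega
      · have := hz.2.2
        simp only [b] at this ⊢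
        rw [affineC_apply_one_sub]; omega
    · rintro ⟨y, hy, rfl⟩
      obtain ⟨h1, h2, h3⟩ := hy
      refine ⟨by change 1 - y ≤ 0; omega, ?_, ?_⟩
      · simp only [a] at h2 ⊢
        rw [affineC_apply_one_sub]; omega
      · simp only [b] at h3 ⊢
        rw [affineC_apply_one_sub]; omega
  have hW : W.Finite := hWZ ▸ hZ.image _
  have hcard : W.ncard = Z.ncard := by
    rw [hWZ]
    exact Set.ncard_image_of_injective _ fun x y hxy => by simpa using hxy
  have e1 : crossing g = X ∪ Z := by
    ext z
    change (1 ≤ z ∧ a z ≤ 0) ↔ (1 ≤ z ∧ a z ≤ 0 ∧ b z ≤ 0) ∨ (1 ≤ z ∧ a z ≤ 0 ∧ 1 ≤ b z)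
    omega
  have e2 : crossing (h * g) = X ∪ Y := by
    ext z
    change (1 ≤ z ∧ b z ≤ 0) ↔ (1 ≤ z ∧ a z ≤ 0 ∧ b z ≤ 0) ∨ (1 ≤ z ∧ 1 ≤ a z ∧ b z ≤ 0)
    omega
  have e3 : crossing h = a '' (Y ∪ W) := by
    ext z
    constructor
    · rintro ⟨h1, h2⟩
      obtain ⟨y, rfl⟩ := ((g : affineA (2 * n)) : Equiv.Perm ℤ).surjective z
      refine ⟨y, ?_, rfl⟩
      rcases le_or_gt 1 y with hy | hy
      · exact Or.inl ⟨hy, h1, h2⟩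
      · exact Or.inr ⟨by omega, h1, h2⟩
    · rintro ⟨y, hy | hy, rfl⟩
      · exact ⟨hy.2.1, hy.2.2⟩
      · exact ⟨hy.2.1, hy.2.2⟩
  have d1 : Disjoint X Z := Set.disjoint_left.2 fun z hx hz => by
    have := hx.2.2; have := hz.2.2; omega
  have d2 : Disjoint X Y := Set.disjoint_left.2 fun z hx hz => by
    have := hx.2.1; have := hz.2.1; omega
  have d3 : Disjoint Y W := Set.disjoint_left.2 fun z hx hz => by
    have := hx.1; have := hz.1; omega
  refine ⟨Z.ncard, ?_⟩
  rw [e1, e2, e3, Set.ncard_image_of_injective _ (Equiv.injective _),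
    Set.ncard_union_eq d1 hX hZ, Set.ncard_union_eq d2 hX hY, Set.ncard_union_eq d3 hY hW, hcard]
  ring

/-- The parity of the number of reflections conjugate to `s_{2n}` in a factorization. -/
noncomputable def crossingSign (n : ℕ) [NeZero n] : affineC n →* ℤˣ where
  toFun g := (-1) ^ (crossing g).ncard
  map_one' := by
    have : crossing (1 : affineC n) = ∅ := Set.eq_empty_of_forall_notMem fun z hz => by
      have h1 := hz.1
      have h2 : z ≤ 0 := hz.2
      omega
    rw [this, Set.ncard_empty, pow_zero]
  map_mul' h g := by
    obtain ⟨m, hm⟩ := ncard_crossing_mul g h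
    rw [← pow_add, add_comm, hm, pow_add, pow_mul]
    simp

theorem crossingSign_apply [NeZero n] (g : affineC n) :
    crossingSign n g = (-1) ^ (crossing g).ncard := rfl

theorem crossingSign_eq_one [NeZero n] {g : affineC n}
    (h : ∀ z : ℤ, 1 ≤ z → 1 ≤ ((g : affineA (2 * n)) : Equiv.Perm ℤ) z) :
    crossingSign n g = 1 := by
  have : crossing g = ∅ := Set.eq_empty_of_forall_notMem fun z hz => by
    have h1 := h z hz.1
    have h2 := hz.2
    omega
  rw [crossingSign_apply, this, Set.ncard_empty, pow_zero]

theorem crossingSign_eq_neg_one [NeZero n] {g : affineC n} (a : ℤ)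
    (h : ∀ z : ℤ, 1 ≤ z ∧ ((g : affineA (2 * n)) : Equiv.Perm ℤ) z ≤ 0 ↔ z = a) :
    crossingSign n g = -1 := by
  have : crossing g = {a} := Set.ext h
  rw [crossingSign_apply, this, Set.ncard_singleton, pow_one]

theorem sub_one_le_s_apply (i z : ℤ) : z - 1 ≤ (s n i : Equiv.Perm ℤ) z := by
  change z - 1 ≤ swapFun (2 * n) i z
  unfold swapFun
  split_ifs <;> omega

theorem one_le_s_apply {i z : ℤ} (hi : ¬ ((2 * n : ℕ) : ℤ) ∣ i) (hz : 1 ≤ z) :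
    1 ≤ (s n i : Equiv.Perm ℤ) z := by
  change 1 ≤ swapFun (2 * n) i z
  unfold swapFun
  split_ifs with h1 h2
  · omega
  · have : z ≠ 1 := by
      rintro rfl
      rw [show 1 - (i + 1) = -i by ring, dvd_neg] at h2
      exact hi h2
    omega
  · exact hz

theorem crossingSign_c [NeZero n] : crossingSign n (c n) = -1 := by
  refine crossingSign_eq_neg_one 2 fun z => ?_
  change (1 ≤ z ∧ (coxA n : Equiv.Perm ℤ) z ≤ 0) ↔ z = 2
  rw [coxA_apply NeZero.one_le]
  split_ifs <;> omega

/-- Here `(a, b)` is `(1, 0)` for conjugates of `σ_0`, `(0, 1)` for those of `σ_n`, and `(0, 0)` for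
the others. The characters are evaluated on simple reflections, only `σ_0` having a crossing. -/
theorem exists_lengthA_le_of_mem [NeZero n] {t : affineC n} (h : t ∈ reflectionsC n) :
    ∃ a b : ℕ, lengthA t + a + b ≤ 2 ∧ crossingSign n t = (-1) ^ a ∧
      Equiv.Perm.sign (residuePerm n t) = (-1) ^ (a + b) := by
  obtain ⟨g, i, hi, e⟩ := h
  have hn : 1 ≤ n := NeZero.one_le
  have hu : ((g⁻¹ * t * g : affineC n) : affineA (2 * n)) = simpleC n i := by
    rw [Subgroup.coe_mul, Subgroup.coe_mul, e, Subgroup.coe_inv]; group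
  have hχ : crossingSign n t = crossingSign n (g⁻¹ * t * g) := by
    rw [map_mul, map_mul, map_inv, mul_right_comm, inv_mul_cancel, one_mul]
  have hone : ∀ j, simpleC n i = s n j → lengthA t ≤ 1 ∧
      Equiv.Perm.sign (residuePerm n (t : affineA (2 * n))) = -1 := by
    intro j hj
    have ht : (t : affineA (2 * n)) ∈ reflectionsA n := ⟨g, j, by rw [e, hj]⟩
    exact ⟨(hasExpr_of_mem ht).genLength_le, sign_residuePerm ht⟩
  by_cases h0 : i = 0
  · have hs : simpleC n i = s n (2 * n) := by rw [simpleC, if_pos h0]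
    obtain ⟨h1, h2⟩ := hone _ hs
    refine ⟨1, 0, by omega, ?_, by rw [h2]; rfl⟩
    rw [hχ, pow_one]
    refine crossingSign_eq_neg_one 1 fun z => ?_
    rw [hu, hs]
    have h3 := sub_one_le_s_apply (n := n) (2 * n) z
    have h4 := isTransposition_s (n := n) (i := 2 * n) (j := 0)
      (intCast_eq_iff.2 ⟨-1, by push_cast; ring⟩)
    constructor
    · omega
    · rintro rfl
      exact ⟨le_rfl, h4.right.le⟩
  by_cases hin : i = n
  · have hs : simpleC n i = s n n := by rw [simpleC, if_neg h0, if_pos hin]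
    obtain ⟨h1, h2⟩ := hone _ hs
    refine ⟨0, 1, by omega, ?_, by rw [h2]; rfl⟩
    rw [hχ, pow_zero]
    refine crossingSign_eq_one fun z hz => ?_
    rw [hu, hs]
    exact one_le_s_apply (not_dvd_of_abs_lt (by omega) (by omega) (by omega)) hz
  · have hs : simpleC n i = s n i * s n (2 * n - i) := by rw [simpleC, if_neg h0, if_neg hin]
    have ht : (t : affineA (2 * n)) = (g * s n i * (g : affineA (2 * n))⁻¹) *
        (g * s n (2 * n - i) * (g : affineA (2 * n))⁻¹) := by
      rw [e, hs]; group
    have hexpr : HasExpr (reflectionsA n) (t : affineA (2 * n)) 2 := by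
      rw [ht]
      exact (hasExpr_of_mem (S := reflectionsA n) ⟨g, i, rfl⟩).mul
        (hasExpr_of_mem (S := reflectionsA n) ⟨g, _, rfl⟩)
    have hlen : lengthA t ≤ 2 := hexpr.genLength_le
    refine ⟨0, 0, by omega, ?_, by rw [hexpr.sign_residuePerm]; rfl⟩
    rw [hχ, pow_zero]
    refine crossingSign_eq_one fun z hz => ?_
    rw [hu, hs, Subgroup.coe_mul, Equiv.Perm.mul_apply]
    exact one_le_s_apply (not_dvd_of_abs_lt (by omega) (by omega) (by omega))
      (one_le_s_apply (not_dvd_of_abs_lt (by omega) (by omega) (by omega)) hz)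

theorem HasExpr.exists_lengthA_le [NeZero n] {g : affineC n} {k : ℕ}
    (h : HasExpr (reflectionsC n) g k) :
    ∃ a b : ℕ, lengthA g + a + b ≤ 2 * k ∧ crossingSign n g = (-1) ^ a ∧
      Equiv.Perm.sign (residuePerm n g) = (-1) ^ (a + b) := by
  obtain ⟨L, rfl, hL, rfl⟩ := h
  induction L with
  | nil =>
    have h1 : lengthA (1 : affineC n) = 0 :=
      Nat.le_zero.1 (hasExpr_one (S := reflectionsA n)).genLength_le
    exact ⟨0, 0, by simp [h1], by simp, by simp⟩
  | cons t L ih =>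
    obtain ⟨a, b, h1, h2, h3⟩ := exists_lengthA_le_of_mem (hL t (by simp))
    obtain ⟨a', b', h1', h2', h3'⟩ := ih fun x hx => hL x (by simp [hx])
    have hl := lengthA_mul_le t L.prod
    refine ⟨a + a', b + b', ?_, ?_, ?_⟩
    · rw [List.prod_cons, List.length_cons]; omega
    · rw [List.prod_cons, map_mul, h2, h2', pow_add]
    · rw [List.prod_cons, Subgroup.coe_mul, map_mul, map_mul, h3, h3', ← pow_add]
      congr 1; ring

/-- The only crossing of `c` is `2 ↦ 0`, so `a` is odd; `c` is a product of `2n` reflections of type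
`Ã`, so `a + b` is even. -/
theorem two_le_of_sign_c [NeZero n] {a b : ℕ} (h1 : crossingSign n (c n) = (-1) ^ a)
    (h2 : Equiv.Perm.sign (residuePerm n (c n : affineA (2 * n))) = (-1) ^ (a + b)) :
    2 ≤ a + b := by
  have ha : a ≠ 0 := by
    rintro rfl
    rw [crossingSign_c, pow_zero] at h1
    exact absurd h1 (by decide)
  obtain ⟨k, hk⟩ := even_add_iff_of_neg_one_pow_eq
    (h2.symm.trans ((hasExpr_coxA n).sign_residuePerm))
  omega

theorem le_lengthC_c [NeZero n] : n + 1 ≤ lengthC (c n) := by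
  obtain ⟨a, b, h1, h2, h3⟩ := (hasExpr_lengthC (c n)).exists_lengthA_le
  have := two_le_of_sign_c h2 h3
  rw [lengthA_c] at h1
  omega

/-- A factorization of the Coxeter element with additive lengths in `W(C̃_n)` has length at most
`2n` in `W(Ã_{2n-1})`. -/
theorem lengthA_add_le [NeZero n] {u v w : affineC n} (hc : u * v * w = c n)
    (hlen : lengthC u + lengthC v + lengthC w ≤ n + 1) :
    lengthA u + lengthA v + lengthA w ≤ 2 * n := by
  obtain ⟨a, b, h1, h2, h3⟩ := (hasExpr_lengthC u).exists_lengthA_le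
  obtain ⟨a', b', h1', h2', h3'⟩ := (hasExpr_lengthC v).exists_lengthA_le
  obtain ⟨a'', b'', h1'', h2'', h3''⟩ := (hasExpr_lengthC w).exists_lengthA_le
  have := two_le_of_sign_c (n := n) (a := a + a' + a'') (b := b + b' + b'')
    (by rw [← hc, map_mul, map_mul, h2, h2', h2'', pow_add, pow_add])
    (by
      rw [← hc, Subgroup.coe_mul, Subgroup.coe_mul, map_mul, map_mul, map_mul, map_mul, h3, h3',
        h3'', ← pow_add, ← pow_add]
      congr 1; ring)
  omega

theorem dividesA_iff (a b : affineC n) :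
    DividesA n a b ↔ lengthA a + lengthA (a⁻¹ * b) = lengthA b := Iff.rfl

theorem dividesC_iff (a b : affineC n) :
    DividesC n a b ↔ lengthC a + lengthC (a⁻¹ * b) = lengthC b := Iff.rfl

end Crossing

end DualCTilde

/-! ### The equivalence -/

open DualCTilde in
theorem mainTheorem6 (n : ℕ) (hn : 1 ≤ n) (w w' : DualCTilde.affineC n) :
    (DualCTilde.DividesC n w w' ∧ DualCTilde.DividesC n w' (DualCTilde.c n)) ↔
      (DualCTilde.DividesA n w w' ∧ DualCTilde.DividesA n w' (DualCTilde.c n)) := by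
  have : NeZero n := ⟨by omega⟩
  have hc : w * (w⁻¹ * w') * (w'⁻¹ * c n) = c n := by group
  rw [dividesC_iff, dividesC_iff, dividesA_iff, dividesA_iff]
  have hA := lengthA_c (n := n)
  have hC := le_antisymm (lengthC_c_le (n := n)) le_lengthC_c
  have e1 : w * (w⁻¹ * w') = w' := by group
  have e2 : w' * (w'⁻¹ * c n) = c n := by group
  -- In each direction the lengths of the three factors add up in one group, which bounds their sum
  -- in the other. Subadditivity along `w'` and `c` then forces equality in both places.
  constructor
  · rintro ⟨h1, h2⟩
    have h := lengthA_add_le hc (by omega)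
    have h3 := lengthA_mul_le w (w⁻¹ * w')
    have h4 := lengthA_mul_le w' (w'⁻¹ * c n)
    rw [e1] at h3
    rw [e2] at h4
    omega
  · rintro ⟨h1, h2⟩
    have h := lengthC_add_le hc (by omega)
    have h3 := lengthC_mul_le w (w⁻¹ * w')
    have h4 := lengthC_mul_le w' (w'⁻¹ * c n)
    rw [e1] at h3
    rw [e2] at h4
    omega
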